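/- Let $1\le k\le n$ be integers. Let $F\colon\mathbb R^n\to[0,\infty)$ be a strongly convex norm of class $C^3(\mathbb R^n\setminus\{0\})$: $F$ is convex, $F(t\xi)=tF(\xi)$ for $t\ge 0$ (evenness is not needed), $F(\xi)>0$ for $\xi\ne0$, and $\nabla^2(\tfrac12F^2)$ is positive definite on $\mathbb R^n\setminus\{0\}$. Subscripts denote partial derivatives. For an $n\times n$ matrix $A$ let $S_k(A)=\frac1{k!}\sum\delta_{i_1\cdots i_k}^{j_1\cdots j_k}A_{i_1j_1}\cdots A_{i_kj_k}$ be the sum of its principal $k\times k$ minors and $S_k^{ij}(A)=\partial S_k(A)/\partial A_{ij}$. Let $\Omega\subset\mathbb R^n$ be a bounded, nonempty open set and $u\in C^2(\Omega)\cap C(\overline\Omega)$ with $u=0$ on $\partial\Omega$. Let $A_F[u]$ be the matrix with entries $\partial_{x_j}\big[\partial_{\xi_i}(\tfrac12F^2)(\nabla u)\big]$ (with $A_F[u]:=0$ where $\nabla u=0$ if $F$ is not the Euclidean norm), and put $S_{k,F}[u]=S_k(A_F[u])$, $S_k^{ij}[u]=S_k^{ij}(A_F[u])$. Let $m=\min_{\overline\Omega}u$,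 $M=\max_{\overline\Omega}u$, $\Sigma_t=\{x\in\Omega:u(x)=t\}$. Where $\nabla u\neq0$ let $\nu=\nabla u/|\nabla u|$ be the unit normal of the level set through the point, and let $S_{k-1}(\kappa_F)$ be the $(k-1)$-th elementary symmetric function of the anisotropic principal curvatures of that level set, i.e. of the $n-1$ eigenvalues of the differential $d\nu_F$ of $\nu_F=\nabla F(\nu)$ on its tangent space; where $\nabla u=0$ the integrand $S_{k-1}(\kappa_F)F^k(\nabla u)F(\nu)$ is understood as $0$. Assume that $\sum_{i,j}S_k^{ij}[u]FF_iu_j$ (with $F,F_i$ evaluated at $\nabla u$, and the product understood as $0$ where $\nabla u=0$) is integrable over $\Omega$. Then: (1) if $(-u)S_{k,F}[u]$ is integrable over $\Omega$ as well, $$\int_\Omega(-u)\,S_{k,F}[u]\,dx=\frac1k\int_\Omega\sum_{i,j}S_k^{ij}[u]\,F F_iu_j\,dx;$$ (2) for a.e. $t\in[m,M]$ the function $S_{k-1}(\kappa_F)F^k(\nabla u)F(\nu)$ is $\mathcal H^{n-1}$-integrable on $\Sigma_t$, its integral over $\Sigma_t$ is integrable in $t\in[m,M]$, and $$\frac1k\int_\Omega\sum_{i,j}S_k^{ij}[u]\,F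 F_iu_j\,dx=\frac1k\int_m^M\int_{\Sigma_t}S_{k-1}(\kappa_F)\,F^k(\nabla u)\,F(\nu)\,d\mathcal H^{n-1}\,dt.$$ -/

import Mathlib

open MeasureTheory

noncomputable section

namespace AnisoHessian

/-- `F` is a strongly convex norm of class `C³` away from the origin: convex, `1`-homogeneous,
positive off the origin, and with `∇²(F²/2)` positive definite off the origin.  Homogeneity is
required for nonnegative factors only, so that every (symmetric) norm is covered and evenness of `F`
is not needed. -/
structure IsStronglyConvexNorm {n : ℕ} (F : EuclideanSpace ℝ (Fin n) → ℝ) : Prop where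
  contDiffOn : ContDiffOn ℝ 3 F {0}ᶜ
  convexOn : ConvexOn ℝ Set.univ F
  map_smul : ∀ (t : ℝ) (ξ : EuclideanSpace ℝ (Fin n)), 0 ≤ t → F (t • ξ) = t * F ξ
  pos : ∀ ξ : EuclideanSpace ℝ (Fin n), ξ ≠ 0 → 0 < F ξ
  hessian_pos : ∀ ξ : EuclideanSpace ℝ (Fin n), ξ ≠ 0 → ∀ v : EuclideanSpace ℝ (Fin n), v ≠ 0 →
    0 < fderiv ℝ (fderiv ℝ (fun η => (1 / 2 : ℝ) * F η ^ 2)) ξ v v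

/-- The generalized Kronecker symbol `δ_{i₁ … i_k}^{j₁ … j_k}`: the sign of the permutation taking
`(i₁, …, i_k)` to `(j₁, …, j_k)` if the `i`'s are distinct and such a (then unique) permutation
exists, and `0` in all other cases. -/
def genKronecker {k n : ℕ} (i j : Fin k → Fin n) : ℝ :=
  open Classical in
  if Function.Injective i then
    ∑ σ : Equiv.Perm (Fin k), if j = i ∘ σ then ((Equiv.Perm.sign σ : ℤ) : ℝ) else 0
  else 0

/-- `S_k(A)`, the sum of the principal `k × k` minors of the (not necessarily symmetric) matrix
`A`. -/
def symmInv {n : ℕ} (k : ℕ) (A : Matrix (Fin n) (Fin n) ℝ) : ℝ :=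
  (1 / (k.factorial : ℝ)) *
    ∑ i : Fin k → Fin n, ∑ j : Fin k → Fin n, genKronecker i j * ∏ a : Fin k, A (i a) (j a)

/-- The Newton transformation `S_k^{ij}(A) = ∂S_k(A) / ∂A_{ij}`. -/
def newton {n : ℕ} (k : ℕ) (A : Matrix (Fin n) (Fin n) ℝ) (i j : Fin n) : ℝ :=
  deriv (fun s : ℝ => symmInv k (A + s • Matrix.single i j (1 : ℝ))) 0

/-- The anisotropic Hessian matrix `A_F[u]`, with entries
`∂_{x_j} [∂_{ξ_i} (F²/2) (∇u)]`, and with `A_F[u] = 0` where `∇u = 0` if `F` is not the Euclidean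
norm. -/
def anisoHessian {n : ℕ} (F u : EuclideanSpace ℝ (Fin n) → ℝ) (x : EuclideanSpace ℝ (Fin n)) :
    Matrix (Fin n) (Fin n) ℝ :=
  open Classical in
  if gradient u x = 0 ∧ F ≠ (fun ξ => ‖ξ‖) then 0
  else Matrix.of fun i j =>
    fderiv ℝ (fun y => (gradient (fun ξ => (1 / 2 : ℝ) * F ξ ^ 2) (gradient u y)) i) x
      (EuclideanSpace.single j (1 : ℝ))

/-- The anisotropic `k`-Hessian operator `S_{k,F}[u] = S_k(A_F[u])`. -/
def anisoHessianOp {n : ℕ} (k : ℕ) (F u : EuclideanSpace ℝ (Fin n) → ℝ)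
    (x : EuclideanSpace ℝ (Fin n)) : ℝ :=
  symmInv k (anisoHessian F u x)

/-- The function `∑_{i,j} S_k^{ij}[u] F F_i u_j`, where `S_k^{ij}[u] = S_k^{ij}(A_F[u])` and `F`,
`F_i` are evaluated at `∇u`. -/
def newtonEnergy {n : ℕ} (k : ℕ) (F u : EuclideanSpace ℝ (Fin n) → ℝ)
    (x : EuclideanSpace ℝ (Fin n)) : ℝ :=
  ∑ i : Fin n, ∑ j : Fin n, newton k (anisoHessian F u x) i j *
    F (gradient u x) * (gradient F (gradient u x)) i * (gradient u x) j

/-- The level set `Σ_t` of `u` in `Ω`. -/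
def levelSet {n : ℕ} (Ω : Set (EuclideanSpace ℝ (Fin n))) (u : EuclideanSpace ℝ (Fin n) → ℝ)
    (t : ℝ) : Set (EuclideanSpace ℝ (Fin n)) :=
  {x | x ∈ Ω ∧ u x = t}

/-- The unit normal `ν = ∇u / |∇u|` of the level sets of `u`, pointing out of the sublevel sets. -/
def levelNormal {n : ℕ} (u : EuclideanSpace ℝ (Fin n) → ℝ) (x : EuclideanSpace ℝ (Fin n)) :
    EuclideanSpace ℝ (Fin n) :=
  ‖gradient u x‖⁻¹ • gradient u x

/-- For a unit normal field `ν` of a hypersurface, extended to a neighbourhood of the point `p` of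
the hypersurface, the differential `dν_F` at `p` of the anisotropic normal `ν_F = ∇F(ν)`, as an
endomorphism of the tangent space `ν(p)ᗮ`.  The tangent space of the Wulff shape at `ν_F(p)` is the
same space `ν(p)ᗮ`, so the orthogonal projection only serves to regard the values of `dν_F` as
elements of it.  The restriction to tangent vectors does not depend on the extension of `ν`. -/
def anisoWeingarten {n : ℕ} (F : EuclideanSpace ℝ (Fin n) → ℝ)
    (ν : EuclideanSpace ℝ (Fin n) → EuclideanSpace ℝ (Fin n)) (p : EuclideanSpace ℝ (Fin n)) :
    ((Submodule.span ℝ {ν p})ᗮ : Submodule ℝ (EuclideanSpace ℝ (Fin n))) →ₗ[ℝ]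
      ((Submodule.span ℝ {ν p})ᗮ : Submodule ℝ (EuclideanSpace ℝ (Fin n))) :=
  ((Submodule.span ℝ {ν p})ᗮ.orthogonalProjectionOnto ∘L
    fderiv ℝ (fun x => gradient F (ν x)) p ∘L (Submodule.span ℝ {ν p})ᗮ.subtypeL).toLinearMap

/-- The anisotropic principal curvatures `κ_F` at `p`: the (real) eigenvalues of `dν_F`, counted
with algebraic multiplicity. -/
def anisoCurvatures {n : ℕ} (F : EuclideanSpace ℝ (Fin n) → ℝ)
    (ν : EuclideanSpace ℝ (Fin n) → EuclideanSpace ℝ (Fin n)) (p : EuclideanSpace ℝ (Fin n)) :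
    Multiset ℝ :=
  (anisoWeingarten F ν p).charpoly.roots

/-- The function `S_{k-1}(κ_F) F^k(∇u) F(ν)` on the level sets of `u`.  It vanishes at the critical
points of `u`, where the level set need not be a hypersurface (for `k ≥ 1` and `F 0 = 0`). -/
def curvatureEnergy {n : ℕ} (k : ℕ) (F u : EuclideanSpace ℝ (Fin n) → ℝ)
    (x : EuclideanSpace ℝ (Fin n)) : ℝ :=
  (anisoCurvatures F (levelNormal u) x).esymm (k - 1) * F (gradient u x) ^ k * F (levelNormal u x)

end AnisoHessian

end

/-! Write `ξ = ∇u`, `c = F(ξ)`, `f = ∇F(ξ)` and `G = D²F(ξ) D²u`. Where `ξ ≠ 0`, the product rule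
gives `A_F[u] = c G + f hᵀ` for some vector `h`. Homogeneity gives `D²F(ξ) ξ = 0`, so `ξᵀ G = 0`.
The function `S_k` is affine along rank-one perturbations, so the term `f hᵀ` does not affect its
increment in the direction `f ξᵀ`, and the energy density equals `F(ξ)^(k+1) S_{k-1}(G)`
(`newtonEnergy_eq`).

Near such a point `ν_F = ∇F(∇u)`, because `∇F` is 0-homogeneous. Hence `dν_F` is the restriction of
`G` to `ξᗮ`, and `G` takes its values there. Being a positive semidefinite matrix times a symmetric
one, `G` has only real eigenvalues, so `S_{k-1}(κ_F) = S_{k-1}(G)` (`esymm_anisoCurvatures`). The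
energy density is therefore `|∇u|` times the curvature integrand, and (2) is the coarea formula on
the open set of noncritical points. That formula is obtained by straightening `u` locally to a
linear function through maps with bilipschitz constant close to 1.

For (1), `∫ S_k(DZ) = 0` for every compactly supported `C¹` field `Z`
(`integral_symmInv_fderiv_eq_zero`). The choice `Z = θ(u) ∇(F²/2)(∇u)`, with `θ ≥ 0` vanishing near
0, formally gives `∫ θ(u)^k S_k + (1/k) (θ^k)'(u) N = 0`, where `S_k` is taken at `A_F[u]` and `N`
is the energy density. No third derivatives of `u` occur. The field `∇(F²/2)` need not be `C¹` at
the origin, so it is first regularized with uniformly bounded derivatives (`exists_regularization`).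
Letting `θ^k` tend to the positive and then to the negative part, and subtracting, gives (1): by the
coarea formula the energy density vanishes almost everywhere on `{u = 0}`. -/

noncomputable section

namespace AnisoHessian

/-! ### Rank-one perturbations of the elementary symmetric functions of a matrix -/

section Algebra

open Matrix Polynomial

/-- Over the fraction field `A` becomes invertible and the usual matrix determinant lemma applies;
`det A • A⁻¹ = adjugate A` clears the inverse. The ring needed below is `ℝ[X]`. -/
theorem det_add_vecMulVec {ι R : Type*} [Fintype ι] [DecidableEq ι] [CommRing R] [IsDomain R]
    (A : Matrix ι ι R) (hA : A.det ≠ 0) (a b : ι → R) :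
    (A + vecMulVec a b).det = A.det + b ⬝ᵥ (adjugate A *ᵥ a) := by
  let f := algebraMap R (FractionRing R)
  have hf : Function.Injective f := IsFractionRing.injective R (FractionRing R)
  apply hf
  have hd : (A.map f).det = f A.det := (RingHom.map_det f A).symm
  have hu : IsUnit (A.map f).det := by
    rw [hd, isUnit_iff_ne_zero]
    exact fun h => hA (hf (by simpa using h))
  have hv : (vecMulVec a b).map f = vecMulVec (f ∘ a) (f ∘ b) := by
    ext i j; simp [vecMulVec_apply]
  have h1 : f (A + vecMulVec a b).det = (A.map f + vecMulVec (f ∘ a) (f ∘ b)).det := by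
    rw [RingHom.map_det, RingHom.mapMatrix_apply, Matrix.map_add _ (map_add f), hv]
  have hadj : adjugate (A.map f) = (adjugate A).map f :=
    (RingHom.map_adjugate f A).symm
  have hinv : (A.map f).det • (A.map f)⁻¹ = (adjugate A).map f := by
    rw [Matrix.inv_def, hadj, smul_smul, Ring.mul_inverse_cancel _ hu, one_smul]
  rw [h1, vecMulVec_eq (ι := Unit), det_add_replicateCol_mul_replicateRow hu, det_unique
    (1 + replicateRow Unit (f ∘ b) * (A.map f)⁻¹ * replicateCol Unit (f ∘ a)),
    Matrix.add_apply, Matrix.one_apply_eq, mul_add, mul_one, hd, map_add, Matrix.mul_assoc,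
    ← replicateCol_mulVec, replicateRow_mul_replicateCol_apply, ← hd, ← smul_eq_mul,
    ← dotProduct_smul, ← smul_mulVec, hinv]
  congr 1
  simp [dotProduct, mulVec, map_sum]

/-- The increment of `symmInv k` under a rank-one perturbation `a bᵀ` of `A`. -/
def rankOneIncrement {n : ℕ} (k : ℕ) (A : Matrix (Fin n) (Fin n) ℝ) (a b : Fin n → ℝ) : ℝ :=
  ((X : ℝ[X]) * ((C ∘ b) ⬝ᵥ (adjugate (1 + (X : ℝ[X]) • A.map C) *ᵥ (C ∘ a)))).coeff k

variable {n : ℕ}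

/-- Each `k`-subset is the image of exactly `k!` injections, and permuting rows and columns
simultaneously leaves the minor unchanged. -/
theorem sum_det_submatrix_injective (k : ℕ) (A : Matrix (Fin n) (Fin n) ℝ) :
    ∑ i : Fin k → Fin n with Function.Injective i, (A.submatrix i i).det =
      (k.factorial : ℝ) * ∑ s ∈ (Finset.univ : Finset (Fin n)).powersetCard k,
        (A.submatrix (Subtype.val : s → Fin n) (Subtype.val : s → Fin n)).det := by
  classical
  rw [← Finset.sum_fiberwise_of_maps_to (t := (Finset.univ : Finset (Fin n)).powersetCard k)
    (g := fun i => Finset.univ.image i), Finset.mul_sum]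
  · refine Finset.sum_congr rfl fun s hs => ?_
    have hcard : Fintype.card (Fin k) = Fintype.card s := by
      simpa using (Finset.mem_powersetCard.1 hs).2.symm
    have : ∑ _e : Fin k ≃ s,
        (A.submatrix (Subtype.val : s → Fin n) (Subtype.val : s → Fin n)).det =
        (k.factorial : ℝ) *
          (A.submatrix (Subtype.val : s → Fin n) (Subtype.val : s → Fin n)).det := by
      rw [Finset.sum_const, Finset.card_univ, Fintype.card_equiv (Fintype.equivOfCardEq hcard)]
      simp
    rw [← this]
    symm
    refine Finset.sum_bij (fun e _ a => (e a : Fin n)) ?_ ?_ ?_ ?_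
    · intro e _
      simp only [Finset.mem_filter, Finset.mem_univ, true_and]
      refine ⟨Subtype.val_injective.comp e.injective, ?_⟩
      ext x
      simp only [Finset.mem_image, Finset.mem_univ, true_and]
      constructor
      · rintro ⟨a, rfl⟩; exact (e a).2
      · intro hx; exact ⟨e.symm ⟨x, hx⟩, by simp⟩
    · intro e _ e' _ h
      ext a
      exact congrArg _ (congrFun h a)
    · intro i hi
      simp only [Finset.mem_filter, Finset.mem_univ, true_and] at hi
      have hm : ∀ a, i a ∈ s := fun a => by rw [← hi.2]; simp
      refine ⟨Equiv.ofBijective (fun a => ⟨i a, hm a⟩) ⟨fun a b h => hi.1 (by simpa using h), ?_⟩,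
        Finset.mem_univ _, rfl⟩
      rintro ⟨x, hx⟩
      rw [← hi.2] at hx
      obtain ⟨a, -, rfl⟩ := Finset.mem_image.1 hx
      exact ⟨a, rfl⟩
    · intro e _
      rw [← Matrix.det_submatrix_equiv_self e, Matrix.submatrix_submatrix]
      rfl
  · intro i hi
    rw [Finset.mem_filter] at hi
    rw [Finset.mem_powersetCard]
    exact ⟨Finset.subset_univ _, by rw [Finset.card_image_of_injective _ hi.2]; simp⟩

/-- For injective `i` the sum over `j` against the Kronecker symbol is the Leibniz expansion of a
principal minor. The generating polynomial makes all `k` accessible to determinant identities at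
once. -/
theorem symmInv_eq_coeff (k : ℕ) (A : Matrix (Fin n) (Fin n) ℝ) :
    symmInv k A = (det (1 + (X : ℝ[X]) • A.map C)).coeff k := by
  classical
  have h : ∀ i : Fin k → Fin n, ∑ j : Fin k → Fin n, genKronecker i j * ∏ a, A (i a) (j a) =
      if Function.Injective i then (A.submatrix i i).det else 0 := by
    intro i
    by_cases hi : Function.Injective i
    · simp only [genKronecker, if_pos hi, Finset.sum_mul, ite_mul, zero_mul]
      rw [Finset.sum_comm, ← Matrix.det_transpose, Matrix.det_apply']
      refine Finset.sum_congr rfl fun σ _ => ?_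
      simp
    · simp [genKronecker, if_neg hi]
  rw [coeff_det_one_add_X_smul_eq_sum_minors, symmInv, Finset.sum_congr rfl fun i _ => h i,
    ← Finset.sum_filter, sum_det_submatrix_injective, ← mul_assoc, one_div,
    inv_mul_cancel₀ (by positivity), one_mul]

/-- The constant coefficient is `S_0(A) = 1`. Thus the determinant lemma applies to `1 + X A` even
when `A` is singular. -/
theorem det_one_add_X_smul_ne_zero (A : Matrix (Fin n) (Fin n) ℝ) :
    (det (1 + (X : ℝ[X]) • A.map C)) ≠ 0 := by
  intro h
  have h0 := symmInv_eq_coeff 0 A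
  rw [h] at h0
  simp [symmInv, genKronecker, Function.injective_of_subsingleton] at h0

theorem symmInv_add_vecMulVec (k : ℕ) (A : Matrix (Fin n) (Fin n) ℝ) (a b : Fin n → ℝ) :
    symmInv k (A + vecMulVec a b) = symmInv k A + rankOneIncrement k A a b := by
  have hmap : (1 : Matrix (Fin n) (Fin n) ℝ[X]) + (X : ℝ[X]) • (A + vecMulVec a b).map C =
      (1 + (X : ℝ[X]) • A.map C) + vecMulVec (C ∘ a) ((X : ℝ[X]) • (C ∘ b)) := by
    ext1 i j
    simp [vecMulVec_apply, Matrix.add_apply]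
    ring
  rw [symmInv_eq_coeff, symmInv_eq_coeff, hmap,
    det_add_vecMulVec _ (det_one_add_X_smul_ne_zero A), coeff_add, smul_dotProduct, smul_eq_mul]
  rfl

theorem rankOneIncrement_smul_left (k : ℕ) (A : Matrix (Fin n) (Fin n) ℝ) (c : ℝ)
    (a b : Fin n → ℝ) : rankOneIncrement k A (c • a) b = c * rankOneIncrement k A a b := by
  have : C ∘ (c • a) = (C c : ℝ[X]) • (C ∘ a) := by ext1 i; simp
  rw [rankOneIncrement, this, mulVec_smul, dotProduct_smul, smul_eq_mul, mul_left_comm, coeff_C_mul]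
  rfl

theorem rankOneIncrement_smul_right (k : ℕ) (A : Matrix (Fin n) (Fin n) ℝ) (c : ℝ)
    (a b : Fin n → ℝ) : rankOneIncrement k A a (c • b) = c * rankOneIncrement k A a b := by
  have : C ∘ (c • b) = (C c : ℝ[X]) • (C ∘ b) := by ext1 i; simp
  rw [rankOneIncrement, this, smul_dotProduct, smul_eq_mul, mul_left_comm, coeff_C_mul]
  rfl

theorem rankOneIncrement_zero_right (k : ℕ) (A : Matrix (Fin n) (Fin n) ℝ) (a : Fin n → ℝ) :
    rankOneIncrement k A a 0 = 0 := by
  simpa using rankOneIncrement_smul_right k A 0 a 0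

theorem rankOneIncrement_sum_left {ι : Type*} (t : Finset ι) (k : ℕ)
    (A : Matrix (Fin n) (Fin n) ℝ) (a : ι → Fin n → ℝ) (b : Fin n → ℝ) :
    rankOneIncrement k A (∑ i ∈ t, a i) b = ∑ i ∈ t, rankOneIncrement k A (a i) b := by
  have : C ∘ (∑ i ∈ t, a i) = ∑ i ∈ t, ((C : ℝ →+* ℝ[X]) ∘ a i) := by ext1 i; simp
  simp only [rankOneIncrement, this, mulVec_sum, dotProduct_sum, Finset.mul_sum, finsetSum_coeff]

theorem rankOneIncrement_sum_right {ι : Type*} (t : Finset ι) (k : ℕ)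
    (A : Matrix (Fin n) (Fin n) ℝ) (a : Fin n → ℝ) (b : ι → Fin n → ℝ) :
    rankOneIncrement k A a (∑ i ∈ t, b i) = ∑ i ∈ t, rankOneIncrement k A a (b i) := by
  have : C ∘ (∑ i ∈ t, b i) = ∑ i ∈ t, ((C : ℝ →+* ℝ[X]) ∘ b i) := by ext1 i; simp
  simp only [rankOneIncrement, this, sum_dotProduct, Finset.mul_sum, finsetSum_coeff]

theorem rankOneIncrement_add_right (k : ℕ) (A : Matrix (Fin n) (Fin n) ℝ) (a b c : Fin n → ℝ) :
    rankOneIncrement k A a (b + c) = rankOneIncrement k A a b + rankOneIncrement k A a c := by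
  have := rankOneIncrement_sum_right (Finset.univ : Finset Bool) k A a (fun i => if i then b else c)
  simpa using this

theorem newton_eq_rankOneIncrement (k : ℕ) (A : Matrix (Fin n) (Fin n) ℝ) (i j : Fin n) :
    newton k A i j = rankOneIncrement k A (Pi.single i 1) (Pi.single j 1) := by
  have h : ∀ s : ℝ, symmInv k (A + s • Matrix.single i j (1 : ℝ)) =
      symmInv k A + s * rankOneIncrement k A (Pi.single i 1) (Pi.single j 1) := by
    intro s
    rw [single_eq_single_vecMulVec_single, ← smul_vecMulVec, symmInv_add_vecMulVec,
      rankOneIncrement_smul_left]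
  simp only [newton, h]
  simp

theorem sum_newton_mul_mul (k : ℕ) (A : Matrix (Fin n) (Fin n) ℝ) (a b : Fin n → ℝ) :
    ∑ i, ∑ j, newton k A i j * a i * b j = rankOneIncrement k A a b := by
  conv_rhs => rw [← Finset.univ_sum_single a, rankOneIncrement_sum_left]
  refine Finset.sum_congr rfl fun i _ => ?_
  conv_rhs => rw [← Finset.univ_sum_single b, rankOneIncrement_sum_right]
  refine Finset.sum_congr rfl fun j _ => ?_
  have h : ∀ (i : Fin n) (x : ℝ), (Pi.single i x : Fin n → ℝ) = x • Pi.single i 1 := by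
    intro i x; rw [← Pi.single_smul]; simp
  rw [h i, h j, rankOneIncrement_smul_left, rankOneIncrement_smul_right,
    newton_eq_rankOneIncrement]
  ring

theorem symmInv_smul (k : ℕ) (c : ℝ) (A : Matrix (Fin n) (Fin n) ℝ) :
    symmInv k (c • A) = c ^ k * symmInv k A := by
  simp only [symmInv, Matrix.smul_apply, smul_eq_mul, Finset.prod_mul_distrib, Finset.prod_const,
    Finset.card_univ, Fintype.card_fin, Finset.mul_sum]
  exact Finset.sum_congr rfl fun i _ => Finset.sum_congr rfl fun j _ => by ring

/-- Homogeneity of degree `k - 1` in `A`, read off from `c A + a bᵀ = c (A + (c⁻¹ a) bᵀ)`. The form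
`c ^ k / c` also covers `k = 0`. -/
theorem rankOneIncrement_smul (k : ℕ) {c : ℝ} (hc : c ≠ 0) (A : Matrix (Fin n) (Fin n) ℝ)
    (a b : Fin n → ℝ) : rankOneIncrement k (c • A) a b = c ^ k / c * rankOneIncrement k A a b := by
  have h1 := symmInv_add_vecMulVec k (c • A) a b
  have h2 := symmInv_add_vecMulVec k A (c⁻¹ • a) b
  have h3 : c • A + vecMulVec a b = c • (A + vecMulVec (c⁻¹ • a) b) := by
    rw [smul_add, smul_vecMulVec, smul_smul, mul_inv_cancel₀ hc, one_smul]
  rw [h3, symmInv_smul, symmInv_smul, h2, rankOneIncrement_smul_left] at h1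
  field_simp at h1 ⊢
  linarith

theorem continuous_symmInv (k : ℕ) :
    Continuous (symmInv k : Matrix (Fin n) (Fin n) ℝ → ℝ) := by
  unfold symmInv
  fun_prop

/-- With `N = 1 + X c G`, the relation `ξ G = 0` gives `ξ N = ξ`, hence `ξ adj(N) = det(N) ξ`. The
bilinear form collapses to `det(N) (ξ · f)`, and the extra factor `X` lowers the index to `k - 1`.
-/
theorem rankOneIncrement_of_vecMul_eq_zero (k : ℕ) (hk : 1 ≤ k) (c : ℝ)
    (G : Matrix (Fin n) (Fin n) ℝ) (f ξ : Fin n → ℝ) (hG : ξ ᵥ* G = 0) :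
    rankOneIncrement k (c • G) f ξ = c ^ (k - 1) * (ξ ⬝ᵥ f) * symmInv (k - 1) G := by
  set N : Matrix (Fin n) (Fin n) ℝ[X] := 1 + (X : ℝ[X]) • (c • G).map C with hN
  have h0 : (C ∘ ξ) ᵥ* N = C ∘ ξ := by
    have : (C ∘ ξ) ᵥ* (c • G).map C = (C : ℝ →+* ℝ[X]) ∘ (ξ ᵥ* (c • G)) := by
      ext1 i; simp [vecMul, dotProduct, map_sum]
    rw [hN, vecMul_add, vecMul_one, vecMul_smul, this, vecMul_smul, hG]
    ext1 i; simp
  have h1 : (C ∘ ξ) ᵥ* adjugate N = N.det • (C ∘ ξ) := by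
    conv_lhs => rw [← h0, vecMul_vecMul, mul_adjugate, vecMul_smul, vecMul_one]
  have h2 : (C ∘ ξ) ⬝ᵥ (C ∘ f) = (C (ξ ⬝ᵥ f) : ℝ[X]) := by
    simp [dotProduct, map_sum]
  obtain ⟨l, rfl⟩ : ∃ l, k = l + 1 := ⟨k - 1, by omega⟩
  rw [rankOneIncrement, dotProduct_mulVec, h1, coeff_X_mul, smul_dotProduct, h2, smul_eq_mul,
    coeff_mul_C, hN, ← symmInv_eq_coeff, symmInv_smul, Nat.add_sub_cancel]
  ring

/-- Expanding `S_k(c G + f (h + ξ)ᵀ)` in one step and in two steps shows that adding `f hᵀ` does not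
change the increment along `f ξᵀ`. -/
theorem sum_newton_of_vecMul_eq_zero (k : ℕ) (hk : 1 ≤ k) (c : ℝ)
    (G : Matrix (Fin n) (Fin n) ℝ) (f h ξ : Fin n → ℝ) (hG : ξ ᵥ* G = 0) :
    ∑ i, ∑ j, newton k (c • G + vecMulVec f h) i j * f i * ξ j =
      c ^ (k - 1) * (ξ ⬝ᵥ f) * symmInv (k - 1) G := by
  rw [sum_newton_mul_mul, ← rankOneIncrement_of_vecMul_eq_zero k hk c G f ξ hG]
  have h1 := symmInv_add_vecMulVec k (c • G + vecMulVec f h) f ξ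
  rw [add_assoc, ← vecMulVec_add, symmInv_add_vecMulVec, symmInv_add_vecMulVec,
    rankOneIncrement_add_right] at h1
  linarith

end Algebra

/-! ### Symmetric functions of the eigenvalues of a compression -/

section Weingarten

open Matrix Polynomial

variable {n : ℕ}

open scoped MatrixOrder Matrix.Norms.L2Operator in
theorem _root_.Matrix.PosSemidef.exists_eq_conjTranspose_mul_self {A : Matrix (Fin n) (Fin n) ℝ}
    (hA : A.PosSemidef) : ∃ B : Matrix (Fin n) (Fin n) ℝ, A = Bᴴ * B :=
  CStarAlgebra.nonneg_iff_eq_star_mul_self.1 hA.nonneg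

/-- With `B = Dᴴ D`, the product `Dᴴ (D H)` has the characteristic polynomial of the Hermitian
matrix `D H Dᴴ`. Semidefiniteness suffices, which matters because `D²F(ξ)` is singular. -/
theorem splits_charpoly_posSemidef_mul {B H : Matrix (Fin n) (Fin n) ℝ} (hB : B.PosSemidef)
    (hH : H.IsHermitian) : (B * H).charpoly.Splits := by
  obtain ⟨D, rfl⟩ := hB.exists_eq_conjTranspose_mul_self
  rw [Matrix.mul_assoc, charpoly_mul_comm]
  exact (isHermitian_mul_mul_conjTranspose D hH).splits_charpoly

theorem charpoly_coeff_eq_symmInv (G : Matrix (Fin n) (Fin n) ℝ) {l : ℕ} (hl : l ≤ n) :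
    G.charpoly.coeff (n - l) = (-1) ^ l * symmInv l G := by
  have := charpoly_coeff_eq_sum_minors G l (by simpa using hl)
  rw [Fintype.card_fin] at this
  rw [this, symmInv_eq_coeff, coeff_det_one_add_X_smul_eq_sum_minors]

theorem finrank_span_singleton_orthogonal {e : EuclideanSpace ℝ (Fin n)} (he : e ≠ 0) :
    Module.finrank ℝ ((Submodule.span ℝ {e})ᗮ : Submodule ℝ (EuclideanSpace ℝ (Fin n))) + 1 =
      n := by
  have := (Submodule.span ℝ {e}).finrank_add_finrank_orthogonal
  rw [finrank_span_singleton he, finrank_euclideanSpace_fin] at this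
  omega

/-- Since `L` takes values in `K = eᗮ`, it factors as `K.subtype ∘ P`, while the compression is `P ∘
K.subtype`. The two characteristic polynomials differ by a power of `X`, the codimension of `K`,
which is 1. -/
theorem charpoly_eq_X_mul_charpoly_compression {e : EuclideanSpace ℝ (Fin n)} (he : e ≠ 0)
    (L : EuclideanSpace ℝ (Fin n) →L[ℝ] EuclideanSpace ℝ (Fin n)) (hL : ∀ v, inner ℝ e (L v) = 0) :
    L.toLinearMap.charpoly = X * ((Submodule.span ℝ {e})ᗮ.orthogonalProjectionOnto ∘L
      L ∘L (Submodule.span ℝ {e})ᗮ.subtypeL).toLinearMap.charpoly := by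
  set K := (Submodule.span ℝ {e})ᗮ with hK
  have hfr : Module.finrank ℝ K + 1 = n := finrank_span_singleton_orthogonal he
  let b := (EuclideanSpace.basisFun (Fin n) ℝ).toBasis
  let bK := (stdOrthonormalBasis ℝ K).toBasis
  let P : EuclideanSpace ℝ (Fin n) →ₗ[ℝ] K := (K.orthogonalProjectionOnto ∘L L).toLinearMap
  have h1 : L.toLinearMap = K.subtype ∘ₗ P := by
    ext1 v
    have : L v ∈ K := by
      rw [hK, Submodule.mem_orthogonal_singleton_iff_inner_right]; exact hL v
    simp [P, Submodule.starProjection_eq_self_iff.2 this]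
  have h2 : (K.orthogonalProjectionOnto ∘L L ∘L K.subtypeL).toLinearMap = P ∘ₗ K.subtype := rfl
  rw [h2, h1, ← LinearMap.charpoly_toMatrix _ b, ← LinearMap.charpoly_toMatrix (P ∘ₗ K.subtype) bK,
    LinearMap.toMatrix_comp b bK b, LinearMap.toMatrix_comp bK b bK, charpoly_mul_comm_of_le]
  · congr 1
    simp only [Fintype.card_fin]
    rw [show n - Module.finrank ℝ K = 1 by omega, pow_one]
  · simp only [Fintype.card_fin]; omega

/-- Vieta's formula requires the characteristic polynomial of the compression to split over `ℝ`; it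
does, as a divisor of the split polynomial of `B * H`. The removed factor `X` accounts for the shift
of the coefficient index. -/
theorem esymm_roots_charpoly_compression {e : EuclideanSpace ℝ (Fin n)} (he : e ≠ 0)
    (L : EuclideanSpace ℝ (Fin n) →L[ℝ] EuclideanSpace ℝ (Fin n)) (hL : ∀ v, inner ℝ e (L v) = 0)
    {B H : Matrix (Fin n) (Fin n) ℝ} (hB : B.PosSemidef) (hH : H.IsHermitian)
    (hBH : LinearMap.toMatrix (EuclideanSpace.basisFun (Fin n) ℝ).toBasis
      (EuclideanSpace.basisFun (Fin n) ℝ).toBasis L.toLinearMap = B * H) {l : ℕ} (hl : l + 1 ≤ n) :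
    ((Submodule.span ℝ {e})ᗮ.orthogonalProjectionOnto ∘L
      L ∘L (Submodule.span ℝ {e})ᗮ.subtypeL).toLinearMap.charpoly.roots.esymm l =
      symmInv l (B * H) := by
  have hfr := finrank_span_singleton_orthogonal he
  have h := charpoly_eq_X_mul_charpoly_compression he L hL
  rw [← LinearMap.charpoly_toMatrix _ (EuclideanSpace.basisFun (Fin n) ℝ).toBasis, hBH] at h
  set p := ((Submodule.span ℝ {e})ᗮ.orthogonalProjectionOnto ∘L
      L ∘L (Submodule.span ℝ {e})ᗮ.subtypeL).toLinearMap.charpoly with hp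
  have hmonic : p.Monic := LinearMap.charpoly_monic _
  have hdeg : p.natDegree = n - 1 := by
    rw [hp, LinearMap.charpoly_natDegree]; omega
  have hs : p.Splits := by
    refine Splits.of_dvd (splits_charpoly_posSemidef_mul hB hH) (charpoly_monic _).ne_zero ?_
    rw [h]; exact dvd_mul_left _ _
  have h1 := coeff_eq_esymm_roots_of_splits hs (k := n - 1 - l) (by omega)
  have h2 := charpoly_coeff_eq_symmInv (B * H) (l := l) (by omega)
  rw [h, show n - l = (n - 1 - l) + 1 by omega, coeff_X_mul, h1, hmonic.leadingCoeff, hdeg,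
    show n - 1 - (n - 1 - l) = l by omega, one_mul] at h2
  exact mul_left_cancel₀ (pow_ne_zero _ (by norm_num)) h2

end Weingarten

/-! ### Calculus of homogeneous strongly convex functions -/

section NormCalculus

open Matrix Filter Topology

variable {n : ℕ}

/-- Euclidean `n`-space. -/
abbrev Eucl (n : ℕ) : Type := EuclideanSpace ℝ (Fin n)

theorem _root_.ContDiffAt.gradient {f : Eucl n → ℝ} {x : Eucl n} {m k : WithTop ℕ∞} (hf : ContDiffAt ℝ k f x)
    (hmk : m + 1 ≤ k) : ContDiffAt ℝ m (gradient f) x := by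
  have h := hf.fderiv_right hmk
  exact (InnerProductSpace.toDual ℝ (Eucl n)).symm.toContinuousLinearEquiv.contDiff.contDiffAt.comp x h

theorem inner_fderiv_gradient {f : Eucl n → ℝ} {x : Eucl n} (hf : ContDiffAt ℝ 2 f x) (v w : Eucl n) :
    inner ℝ (fderiv ℝ (gradient f) x v) w = fderiv ℝ (fderiv ℝ f) x v w := by
  have hg : DifferentiableAt ℝ (gradient f) x :=
    (hf.gradient (m := 1) (by norm_num)).differentiableAt one_ne_zero
  have hd : DifferentiableAt ℝ (fderiv ℝ f) x :=
    (hf.fderiv_right (m := 1) (by norm_num)).differentiableAt one_ne_zero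
  have h1 := ((innerSL ℝ w).hasFDerivAt.comp x hg.hasFDerivAt)
  have h2 := hd.hasFDerivAt.clm_apply (hasFDerivAt_const w x)
  have h3 : (innerSL ℝ w) ∘ gradient f = fun y => fderiv ℝ f y w := by
    ext y
    exact (real_inner_comm (gradient f y) w).trans inner_gradient_left
  rw [h3] at h1
  have := congrArg (fun T => T v) (h1.unique h2)
  simpa [real_inner_comm] using this

theorem inner_fderiv_gradient_comm {f : Eucl n → ℝ} {x : Eucl n} (hf : ContDiffAt ℝ 2 f x) (v w : Eucl n) :
    inner ℝ (fderiv ℝ (gradient f) x v) w = inner ℝ v (fderiv ℝ (gradient f) x w) := by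
  rw [real_inner_comm (fderiv ℝ (gradient f) x w), inner_fderiv_gradient hf,
    inner_fderiv_gradient hf]
  exact (hf.isSymmSndFDerivAt (by simp)).eq v w

/-- The matrix of an endomorphism of Euclidean space in the standard basis. -/
def euclMatrix (L : Eucl n →L[ℝ] Eucl n) : Matrix (Fin n) (Fin n) ℝ :=
  LinearMap.toMatrix (EuclideanSpace.basisFun (Fin n) ℝ).toBasis
    (EuclideanSpace.basisFun (Fin n) ℝ).toBasis L.toLinearMap

theorem euclMatrix_apply (L : Eucl n →L[ℝ] Eucl n) (i j : Fin n) :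
    euclMatrix L i j = L (EuclideanSpace.single j 1) i := by
  simp [euclMatrix, LinearMap.toMatrix_apply]

theorem euclMatrix_comp (L T : Eucl n →L[ℝ] Eucl n) :
    euclMatrix (L ∘L T) = euclMatrix L * euclMatrix T :=
  LinearMap.toMatrix_comp _ _ _ _ _

theorem euclMatrix_mulVec (L : Eucl n →L[ℝ] Eucl n) (v : Eucl n) :
    euclMatrix L *ᵥ v.ofLp = (L v).ofLp := by
  have := LinearMap.toMatrix_mulVec_repr (EuclideanSpace.basisFun (Fin n) ℝ).toBasis
    (EuclideanSpace.basisFun (Fin n) ℝ).toBasis L.toLinearMap v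
  exact this

theorem euclMatrix_isHermitian {L : Eucl n →L[ℝ] Eucl n} (hL : ∀ v w, inner ℝ (L v) w = inner ℝ v (L w)) :
    (euclMatrix L).IsHermitian := by
  ext i j
  have := hL (EuclideanSpace.single i 1) (EuclideanSpace.single j 1)
  simp only [EuclideanSpace.inner_single_left, EuclideanSpace.inner_single_right] at this
  simpa [euclMatrix_apply] using this

theorem euclMatrix_posSemidef {L : Eucl n →L[ℝ] Eucl n} (hL : ∀ v w, inner ℝ (L v) w = inner ℝ v (L w))
    (hp : ∀ v, 0 ≤ inner ℝ (L v) v) : (euclMatrix L).PosSemidef := by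
  refine posSemidef_iff_dotProduct_mulVec.2 ⟨euclMatrix_isHermitian hL, fun x => ?_⟩
  have h := hp (WithLp.toLp 2 x)
  have h2 := euclMatrix_mulVec L (WithLp.toLp 2 x)
  simp only at h2
  rw [h2]
  simpa [PiLp.inner_apply, dotProduct, mul_comm] using h

theorem fderiv_apply_coord {f : Eucl n → Eucl n} {x : Eucl n} (hf : DifferentiableAt ℝ f x) (v : Eucl n) (i : Fin n) :
    fderiv ℝ (fun y => f y i) x v = fderiv ℝ f x v i := by
  have := (EuclideanSpace.proj (𝕜 := ℝ) i : Eucl n →L[ℝ] ℝ).hasFDerivAt.comp x hf.hasFDerivAt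
  exact congrArg (fun T => T v) this.fderiv

namespace IsStronglyConvexNorm

variable {F : Eucl n → ℝ}

theorem contDiffAt (hF : IsStronglyConvexNorm F) {ξ : Eucl n} (hξ : ξ ≠ 0) : ContDiffAt ℝ 3 F ξ :=
  hF.contDiffOn.contDiffAt (isOpen_compl_singleton.mem_nhds hξ)

theorem differentiableAt (hF : IsStronglyConvexNorm F) {ξ : Eucl n} (hξ : ξ ≠ 0) :
    DifferentiableAt ℝ F ξ :=
  (hF.contDiffAt hξ).differentiableAt (by norm_num)

theorem contDiffAt_gradient (hF : IsStronglyConvexNorm F) {ξ : Eucl n} (hξ : ξ ≠ 0) :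
    ContDiffAt ℝ 2 (gradient F) ξ :=
  (hF.contDiffAt hξ).gradient (by norm_num)

theorem differentiableAt_gradient (hF : IsStronglyConvexNorm F) {ξ : Eucl n} (hξ : ξ ≠ 0) :
    DifferentiableAt ℝ (gradient F) ξ :=
  (hF.contDiffAt_gradient hξ).differentiableAt (by norm_num)

theorem map_zero (hF : IsStronglyConvexNorm F) : F 0 = 0 := by
  simpa using hF.map_smul 0 0 le_rfl

theorem inner_gradient_self (hF : IsStronglyConvexNorm F) {ξ : Eucl n} (hξ : ξ ≠ 0) :
    inner ℝ (gradient F ξ) ξ = F ξ := by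
  rw [inner_gradient_left]
  have h1 : HasDerivAt (fun t : ℝ => t • ξ) ξ 1 := by
    simpa using (hasDerivAt_id (1 : ℝ)).smul_const ξ
  have h2 : HasFDerivAt F (fderiv ℝ F ξ) ((1 : ℝ) • ξ) := by
    rw [one_smul]; exact (hF.differentiableAt hξ).hasFDerivAt
  have h3 := h2.comp_hasDerivAt 1 h1
  have h4 : HasDerivAt (fun t : ℝ => t * F ξ) (F ξ) 1 := by
    simpa using (hasDerivAt_id (1 : ℝ)).mul_const (F ξ)
  refine h3.unique (h4.congr_of_eventuallyEq ?_)
  filter_upwards [lt_mem_nhds (zero_lt_one (α := ℝ))] with t ht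
  exact hF.map_smul t ξ ht.le

theorem gradient_smul (hF : IsStronglyConvexNorm F) {ξ : Eucl n} (hξ : ξ ≠ 0) {t : ℝ} (ht : 0 < t) :
    gradient F (t • ξ) = gradient F ξ := by
  have hd := (hF.differentiableAt (smul_ne_zero ht.ne' hξ)).hasFDerivAt.comp ξ
    ((hasFDerivAt_id ξ).const_smul t)
  have hd2 := (hF.differentiableAt hξ).hasFDerivAt.const_smul t
  have h : F ∘ HSMul.hSMul t = t • F := by
    ext y; exact hF.map_smul t y ht.le
  refine ext_inner_right ℝ fun v => ?_
  rw [h] at hd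
  have := congrArg (fun T => T v) (hd.unique hd2)
  simp only [ContinuousLinearMap.comp_apply, _root_.smul_apply,
    ContinuousLinearMap.id_apply, _root_.map_smul, smul_eq_mul] at this
  rw [inner_gradient_left, inner_gradient_left]
  exact mul_left_cancel₀ ht.ne' this

theorem fderiv_gradient_apply_self (hF : IsStronglyConvexNorm F) {ξ : Eucl n} (hξ : ξ ≠ 0) :
    fderiv ℝ (gradient F) ξ ξ = 0 := by
  have h1 : HasDerivAt (fun t : ℝ => t • ξ) ξ 1 := by
    simpa using (hasDerivAt_id (1 : ℝ)).smul_const ξ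
  have h2 : HasFDerivAt (gradient F) (fderiv ℝ (gradient F) ξ) ((1 : ℝ) • ξ) := by
    rw [one_smul]; exact (hF.differentiableAt_gradient hξ).hasFDerivAt
  have h3 := h2.comp_hasDerivAt 1 h1
  refine h3.unique ((hasDerivAt_const 1 (gradient F ξ)).congr_of_eventuallyEq ?_)
  filter_upwards [lt_mem_nhds (zero_lt_one (α := ℝ))] with t ht
  exact hF.gradient_smul hξ ht

theorem inner_fderiv_gradient_comm (hF : IsStronglyConvexNorm F) {ξ : Eucl n} (hξ : ξ ≠ 0) (v w : Eucl n) :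
    inner ℝ (fderiv ℝ (gradient F) ξ v) w = inner ℝ v (fderiv ℝ (gradient F) ξ w) :=
  AnisoHessian.inner_fderiv_gradient_comm ((hF.contDiffAt hξ).of_le (by norm_num)) v w

theorem inner_fderiv_gradient_self_right (hF : IsStronglyConvexNorm F) {ξ : Eucl n} (hξ : ξ ≠ 0)
    (v : Eucl n) : inner ℝ ξ (fderiv ℝ (gradient F) ξ v) = 0 := by
  rw [← hF.inner_fderiv_gradient_comm hξ, hF.fderiv_gradient_apply_self hξ, inner_zero_left]

theorem gradient_half_sq (hF : IsStronglyConvexNorm F) {ξ : Eucl n} (hξ : ξ ≠ 0) :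
    gradient (fun η => (1 / 2 : ℝ) * F η ^ 2) ξ = F ξ • gradient F ξ := by
  refine ext_inner_right ℝ fun v => ?_
  have h := ((hF.differentiableAt hξ).hasFDerivAt.pow 2).const_mul (1 / 2 : ℝ)
  rw [inner_gradient_left, h.fderiv, real_inner_smul_left, inner_gradient_left]
  simp
  ring

theorem contDiffAt_gradient_half_sq (hF : IsStronglyConvexNorm F) {ξ : Eucl n} (hξ : ξ ≠ 0) :
    ContDiffAt ℝ 2 (gradient (fun η => (1 / 2 : ℝ) * F η ^ 2)) ξ :=
  (contDiffAt_const.mul ((hF.contDiffAt hξ).pow 2)).gradient (by norm_num)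

theorem fderiv_gradient_half_sq (hF : IsStronglyConvexNorm F) {ξ : Eucl n} (hξ : ξ ≠ 0) (v : Eucl n) :
    fderiv ℝ (gradient (fun η => (1 / 2 : ℝ) * F η ^ 2)) ξ v =
      F ξ • fderiv ℝ (gradient F) ξ v + (inner ℝ (gradient F ξ) v : ℝ) • gradient F ξ := by
  have h := (hF.differentiableAt hξ).hasFDerivAt.smul (hF.differentiableAt_gradient hξ).hasFDerivAt
  have he : gradient (fun η => (1 / 2 : ℝ) * F η ^ 2) =ᶠ[𝓝 ξ] fun η => F η • gradient F η := by
    filter_upwards [isOpen_compl_singleton.mem_nhds hξ] with η hη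
    exact hF.gradient_half_sq hη
  rw [(h.congr_of_eventuallyEq he).fderiv, inner_gradient_left]
  simp

/-- On vectors orthogonal to `∇F(ξ)`, the Hessian of `F²/2` reduces to `F D²F`. Any `v` can be moved
there along `ξ`, which lies in the kernel of `D²F(ξ)`. -/
theorem fderiv_gradient_nonneg (hF : IsStronglyConvexNorm F) {ξ : Eucl n} (hξ : ξ ≠ 0) (v : Eucl n) :
    0 ≤ inner ℝ (fderiv ℝ (gradient F) ξ v) v := by
  have hpos := hF.pos ξ hξ
  -- By Euler's relation `⟨∇F(ξ), ξ⟩ = F(ξ)`, this `c` makes `v - c ξ` orthogonal to `∇F(ξ)`.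
  set c : ℝ := inner ℝ (gradient F ξ) v / F ξ with hc
  set w := v - c • ξ with hw
  have hDw : fderiv ℝ (gradient F) ξ w = fderiv ℝ (gradient F) ξ v := by
    rw [hw, map_sub, _root_.map_smul, hF.fderiv_gradient_apply_self hξ, smul_zero, sub_zero]
  have hww : inner ℝ (fderiv ℝ (gradient F) ξ w) w = inner ℝ (fderiv ℝ (gradient F) ξ v) v := by
    rw [hDw, hw, inner_sub_right, real_inner_smul_right, real_inner_comm ξ,
      hF.inner_fderiv_gradient_self_right hξ, mul_zero, sub_zero]
  rw [← hww]
  by_cases h0 : w = 0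
  · simp [h0]
  have hfw : inner ℝ (gradient F ξ) w = 0 := by
    rw [hw, inner_sub_right, real_inner_smul_right, hF.inner_gradient_self hξ, hc,
      div_mul_cancel₀ _ hpos.ne', sub_self]
  have hs : ContDiffAt ℝ 2 (fun η => (1 / 2 : ℝ) * F η ^ 2) ξ :=
    (contDiffAt_const.mul ((hF.contDiffAt hξ).pow 2)).of_le (by norm_num)
  have h := hF.hessian_pos ξ hξ w h0
  rw [← inner_fderiv_gradient hs, hF.fderiv_gradient_half_sq hξ, hfw, zero_smul, add_zero,
    real_inner_smul_left] at h
  exact (pos_of_mul_pos_right h hpos.le).le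

end IsStronglyConvexNorm

end NormCalculus

/-! ### Pointwise identity between the energy density and the curvature integrand -/

section Pointwise

open Matrix Filter Topology

variable {n : ℕ} {F u : Eucl n → ℝ} {x : Eucl n}

theorem anisoHessian_of_differentiableAt (h : ¬(gradient u x = 0 ∧ F ≠ fun ξ => ‖ξ‖))
    (hd : DifferentiableAt ℝ
      (fun y => gradient (fun ξ => (1 / 2 : ℝ) * F ξ ^ 2) (gradient u y)) x) :
    anisoHessian F u x = euclMatrix
      (fderiv ℝ (fun y => gradient (fun ξ => (1 / 2 : ℝ) * F ξ ^ 2) (gradient u y)) x) := by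
  rw [anisoHessian, if_neg h]
  ext i j
  rw [euclMatrix_apply, of_apply, fderiv_apply_coord hd]

namespace IsStronglyConvexNorm

theorem hasFDerivAt_gradient_comp (hF : IsStronglyConvexNorm F) (hu : ContDiffAt ℝ 2 u x)
    (hx : gradient u x ≠ 0) :
    HasFDerivAt (fun y => gradient (fun ξ => (1 / 2 : ℝ) * F ξ ^ 2) (gradient u y))
      (fderiv ℝ (gradient (fun ξ => (1 / 2 : ℝ) * F ξ ^ 2)) (gradient u x) ∘L
        fderiv ℝ (gradient u) x) x :=
  HasFDerivAt.comp x
    ((hF.contDiffAt_gradient_half_sq hx).differentiableAt (by norm_num)).hasFDerivAt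
    ((hu.gradient (m := 1) (by norm_num)).differentiableAt (by norm_num)).hasFDerivAt

theorem anisoHessian_eq_euclMatrix (hF : IsStronglyConvexNorm F) (hu : ContDiffAt ℝ 2 u x)
    (hx : gradient u x ≠ 0) :
    anisoHessian F u x =
      euclMatrix (fderiv ℝ (gradient (fun ξ => (1 / 2 : ℝ) * F ξ ^ 2)) (gradient u x) ∘L
        fderiv ℝ (gradient u) x) := by
  have h := hF.hasFDerivAt_gradient_comp hu hx
  rw [anisoHessian_of_differentiableAt (fun h => hx h.1) h.differentiableAt, h.fderiv]

theorem anisoHessian_eq_add (hF : IsStronglyConvexNorm F) (hu : ContDiffAt ℝ 2 u x)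
    (hx : gradient u x ≠ 0) :
    anisoHessian F u x =
      F (gradient u x) • (euclMatrix (fderiv ℝ (gradient F) (gradient u x)) *
        euclMatrix (fderiv ℝ (gradient u) x)) +
      vecMulVec (gradient F (gradient u x)).ofLp
        (fun j => inner ℝ (gradient F (gradient u x))
          (fderiv ℝ (gradient u) x (EuclideanSpace.single j 1))) := by
  rw [hF.anisoHessian_eq_euclMatrix hu hx, ← euclMatrix_comp]
  ext i j
  simp only [euclMatrix_apply, Matrix.add_apply, Matrix.smul_apply, vecMulVec_apply,
    ContinuousLinearMap.comp_apply, hF.fderiv_gradient_half_sq hx, PiLp.add_apply, PiLp.smul_apply,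
    smul_eq_mul]
  ring

/-- The rank-one part of the Hessian has left factor `∇F(∇u)`, the vector against which the Newton
tensor is contracted, so it drops out. One factor `F` is in the definition, `k - 1` come from
homogeneity and one from Euler's relation. -/
theorem newtonEnergy_eq (hF : IsStronglyConvexNorm F) (hu : ContDiffAt ℝ 2 u x)
    (hx : gradient u x ≠ 0) {k : ℕ} (hk : 1 ≤ k) :
    newtonEnergy k F u x = F (gradient u x) ^ (k + 1) *
      symmInv (k - 1) (euclMatrix (fderiv ℝ (gradient F) (gradient u x)) *
        euclMatrix (fderiv ℝ (gradient u) x)) := by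
  have hG : (gradient u x).ofLp ᵥ* (euclMatrix (fderiv ℝ (gradient F) (gradient u x)) *
        euclMatrix (fderiv ℝ (gradient u) x)) = 0 := by
    rw [← euclMatrix_comp]
    ext j
    have := hF.inner_fderiv_gradient_self_right hx
      (fderiv ℝ (gradient u) x (EuclideanSpace.single j 1))
    simpa [vecMul, dotProduct, euclMatrix_apply, PiLp.inner_apply, mul_comm,
      -inner_gradient_left, -inner_gradient_right] using this
  have hf : (gradient u x).ofLp ⬝ᵥ (gradient F (gradient u x)).ofLp = F (gradient u x) := by
    rw [← hF.inner_gradient_self hx]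
    simp [dotProduct, PiLp.inner_apply, -inner_gradient_left, -inner_gradient_right]
  have h := sum_newton_of_vecMul_eq_zero k hk (F (gradient u x)) _
    (gradient F (gradient u x)).ofLp (fun j => inner ℝ (gradient F (gradient u x))
          (fderiv ℝ (gradient u) x (EuclideanSpace.single j 1))) _ hG
  rw [← hF.anisoHessian_eq_add hu hx, hf] at h
  obtain ⟨l, rfl⟩ : ∃ l, k = l + 1 := ⟨k - 1, by omega⟩
  rw [Nat.add_sub_cancel] at h ⊢
  calc newtonEnergy (l + 1) F u x = F (gradient u x) * ∑ i, ∑ j, newton (l + 1)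
        (anisoHessian F u x) i j * gradient F (gradient u x) i * gradient u x j := by
        simp only [newtonEnergy, Finset.mul_sum]
        exact Finset.sum_congr rfl fun i _ => Finset.sum_congr rfl fun j _ => by ring
    _ = _ := by rw [h]; ring

/-- By 0-homogeneity of `∇F` the normalization of `∇u` is invisible near `x`, so the differential is
`D²F(∇u) D²u`, whose range is orthogonal to `∇u`. -/
theorem esymm_anisoCurvatures (hF : IsStronglyConvexNorm F) (hu : ContDiffAt ℝ 2 u x)
    (hx : gradient u x ≠ 0) {l : ℕ} (hl : l + 1 ≤ n) :
    (anisoCurvatures F (levelNormal u) x).esymm l =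
      symmInv l (euclMatrix (fderiv ℝ (gradient F) (gradient u x)) *
        euclMatrix (fderiv ℝ (gradient u) x)) := by
  have hdu := (hu.gradient (m := 1) (by norm_num))
  have hev : (fun y => gradient F (levelNormal u y)) =ᶠ[𝓝 x] fun y => gradient F (gradient u y) := by
    filter_upwards [hdu.continuousAt.eventually_ne hx] with y hy
    exact hF.gradient_smul hy (by positivity)
  have hd : HasFDerivAt (fun y => gradient F (gradient u y))
      (fderiv ℝ (gradient F) (gradient u x) ∘L fderiv ℝ (gradient u) x) x :=
    HasFDerivAt.comp x (hF.differentiableAt_gradient hx).hasFDerivAt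
      (hdu.differentiableAt (by norm_num)).hasFDerivAt
  have hfd := (hd.congr_of_eventuallyEq hev).fderiv
  have he : levelNormal u x ≠ 0 := smul_ne_zero (inv_ne_zero (norm_ne_zero_iff.2 hx)) hx
  rw [anisoCurvatures, anisoWeingarten, hfd]
  refine esymm_roots_charpoly_compression he _ (fun v => ?_)
    (euclMatrix_posSemidef (hF.inner_fderiv_gradient_comm hx) (hF.fderiv_gradient_nonneg hx))
    (euclMatrix_isHermitian (AnisoHessian.inner_fderiv_gradient_comm hu))
    (euclMatrix_comp _ _) hl
  rw [levelNormal, real_inner_smul_left]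
  exact mul_eq_zero_of_right _ (hF.inner_fderiv_gradient_self_right hx _)

theorem newtonEnergy_eq_norm_mul_curvatureEnergy (hF : IsStronglyConvexNorm F)
    (hu : ContDiffAt ℝ 2 u x) (hx : gradient u x ≠ 0) {k : ℕ} (hk : 1 ≤ k) (hkn : k ≤ n) :
    newtonEnergy k F u x = ‖gradient u x‖ * curvatureEnergy k F u x := by
  have hn : ‖gradient u x‖ ≠ 0 := norm_ne_zero_iff.2 hx
  rw [hF.newtonEnergy_eq hu hx hk, curvatureEnergy, hF.esymm_anisoCurvatures hu hx (by omega),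
    levelNormal, hF.map_smul _ _ (by positivity)]
  field_simp
  ring

theorem curvatureEnergy_of_gradient_eq_zero (hF : IsStronglyConvexNorm F) (hx : gradient u x = 0)
    (k : ℕ) : curvatureEnergy k F u x = 0 := by
  rw [curvatureEnergy, levelNormal, hx, smul_zero, hF.map_zero, mul_zero]

end IsStronglyConvexNorm

theorem newtonEnergy_of_gradient_eq_zero (hx : gradient u x = 0) (k : ℕ) :
    newtonEnergy k F u x = 0 := by
  simp [newtonEnergy, hx]

end Pointwise

/-! ### Null Lagrangians by change of variables -/

section NullLagrangian

open Matrix Polynomial Set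
open scoped NNReal

variable {n : ℕ}

theorem det_one_add_smul_eq_sum_symmInv (A : Matrix (Fin n) (Fin n) ℝ) (s : ℝ) :
    (1 + s • A).det = ∑ j ∈ Finset.range (n + 1), symmInv j A * s ^ j := by
  have h1 : (1 + s • A).det = (det (1 + (X : ℝ[X]) • A.map C)).eval s := by
    rw [← coe_evalRingHom, RingHom.map_det]
    congr 1
    ext i j
    by_cases hij : i = j <;> simp [hij] <;> ring
  have h2 : (det (1 + (X : ℝ[X]) • A.map C)).natDegree < n + 1 := by
    have := natDegree_det_X_add_C_le A 1
    rw [Matrix.map_one C (by simp) (by simp), add_comm] at this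
    simpa [Nat.lt_succ_iff] using this
  rw [h1, eval_eq_sum_range' h2]
  exact Finset.sum_congr rfl fun j _ => by rw [symmInv_eq_coeff]

theorem det_id_add_eq (L : Eucl n →L[ℝ] Eucl n) :
    (ContinuousLinearMap.id ℝ (Eucl n) + L).det = (1 + euclMatrix L).det := by
  rw [ContinuousLinearMap.det, ← LinearMap.det_toMatrix (EuclideanSpace.basisFun (Fin n) ℝ).toBasis]
  congr 1
  ext i j
  simp [euclMatrix, LinearMap.toMatrix_apply, Matrix.one_apply]

/-- A negative value would force, by continuity along `t ↦ 1 + t L`, a singular matrix for some `t`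
in `[0, 1]`; a kernel vector satisfies `v = -t L v`, contradicting `‖L‖ < 1`. -/
theorem det_one_add_nonneg_of_norm_lt_one {L : Eucl n →L[ℝ] Eucl n} (hL : ‖L‖ < 1) :
    0 ≤ (1 + euclMatrix L).det := by
  by_contra! hneg
  let f : ℝ → ℝ := fun t => (1 + t • euclMatrix L).det
  have hf : Continuous f := by
    unfold f; fun_prop
  obtain ⟨t, ht, hft⟩ : (0 : ℝ) ∈ f '' Icc 0 1 := by
    refine intermediate_value_Icc' zero_le_one hf.continuousOn ⟨?_, ?_⟩
    · simpa [f] using hneg.le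
    · simp [f]
  have h0 : (1 + t • euclMatrix L) = euclMatrix (ContinuousLinearMap.id ℝ (Eucl n) + t • L) := by
    ext i j
    simp [euclMatrix_apply, Matrix.one_apply]
  obtain ⟨v, hv, hv0⟩ := Matrix.exists_mulVec_eq_zero_iff.2 hft
  rw [h0] at hv0
  have h1 := euclMatrix_mulVec (ContinuousLinearMap.id ℝ (Eucl n) + t • L) (WithLp.toLp 2 v)
  rw [hv0] at h1
  have h2 : WithLp.toLp 2 v + t • L (WithLp.toLp 2 v) = 0 := by
    ext i; simpa using (congrFun h1 i).symm
  have hv' : 0 < ‖(WithLp.toLp 2 v : Eucl n)‖ := by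
    rw [norm_pos_iff]; simpa using hv
  have h3 : ‖(WithLp.toLp 2 v : Eucl n)‖ ≤ ‖L‖ * ‖(WithLp.toLp 2 v : Eucl n)‖ := by
    calc ‖(WithLp.toLp 2 v : Eucl n)‖ = ‖t • L (WithLp.toLp 2 v)‖ := by
          rw [← norm_neg (t • _), ← eq_neg_of_add_eq_zero_left h2]
      _ ≤ 1 * ‖L (WithLp.toLp 2 v)‖ := by
          rw [norm_smul, Real.norm_of_nonneg ht.1]
          exact mul_le_mul_of_nonneg_right ht.2 (norm_nonneg _)
      _ ≤ _ := by rw [one_mul]; exact L.le_opNorm _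
  nlinarith

/-- The map `x + Z x` is a bijection, as a small Lipschitz perturbation of the identity, and it
fixes every point outside the ball. Hence it maps the ball onto itself, and the change of variables
formula computes its volume. -/
theorem setIntegral_det_id_add_fderiv {Z : Eucl n → Eucl n} (hZ : ContDiff ℝ 1 Z) {c : ℝ≥0}
    (hc : c < 1) (hlip : LipschitzWith c Z) {R : ℝ} (hR : ∀ x ∉ Metric.closedBall 0 R, Z x = 0) :
    ∫ x in Metric.closedBall (0 : Eucl n) R, (1 + euclMatrix (fderiv ℝ Z x)).det =
      volume.real (Metric.closedBall (0 : Eucl n) R) := by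
  set B := Metric.closedBall (0 : Eucl n) R with hB
  let Ψ : Eucl n → Eucl n := fun x => x + Z x
  have happ : ApproximatesLinearOn Ψ
      ((ContinuousLinearEquiv.refl ℝ (Eucl n) : Eucl n ≃L[ℝ] Eucl n) : Eucl n →L[ℝ] Eucl n)
      univ c := by
    intro x _ y _
    have h : Ψ x - Ψ y - (x - y) = Z x - Z y := by simp only [Ψ]; abel
    simpa [h, dist_eq_norm] using hlip.dist_le_mul x y
  have hcc : Subsingleton (Eucl n) ∨ c < ‖((ContinuousLinearEquiv.refl ℝ (Eucl n)).symm :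
      Eucl n →L[ℝ] Eucl n)‖₊⁻¹ := by
    rcases subsingleton_or_nontrivial (Eucl n) with h | h
    · exact Or.inl h
    · right
      simpa using hc
  have hbij : Function.Bijective Ψ := (happ.toHomeomorph Ψ hcc).bijective
  have himg : Ψ '' B = B := by
    have hfix : ∀ x ∉ B, Ψ x = x := fun x hx => by simp [Ψ, hR x hx]
    ext y
    constructor
    · rintro ⟨x, hx, rfl⟩
      by_contra hy
      exact hy (by rw [hbij.1 (hfix _ hy)]; exact hx)
    · intro hy
      obtain ⟨x, rfl⟩ := hbij.2 y
      by_cases hx : x ∈ B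
      · exact ⟨x, hx, rfl⟩
      · exact absurd (hfix x hx ▸ hy) hx
  have hd : ∀ x, HasFDerivAt Ψ (ContinuousLinearMap.id ℝ (Eucl n) + fderiv ℝ Z x) x := fun x =>
    (hasFDerivAt_id x).add (hZ.differentiable (by norm_num) x).hasFDerivAt
  have h := integral_image_eq_integral_abs_det_fderiv_smul volume
    (Metric.isClosed_closedBall.measurableSet : MeasurableSet B)
    (fun x _ => (hd x).hasFDerivWithinAt) hbij.1.injOn (fun _ => (1 : ℝ))
  rw [himg] at h
  simp only [integral_const, smul_eq_mul, mul_one, measureReal_restrict_apply_univ] at h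
  rw [h]
  refine setIntegral_congr_fun Metric.isClosed_closedBall.measurableSet fun x _ => ?_
  simp only [det_id_add_eq]
  rw [abs_of_nonneg]
  exact det_one_add_nonneg_of_norm_lt_one
    ((norm_fderiv_le_of_lipschitz ℝ hlip).trans_lt (by exact_mod_cast hc))

theorem continuous_euclMatrix : Continuous (euclMatrix : (Eucl n →L[ℝ] Eucl n) → _) := by
  refine continuous_matrix fun i j => ?_
  simp only [euclMatrix_apply]
  fun_prop

theorem euclMatrix_zero : euclMatrix (0 : Eucl n →L[ℝ] Eucl n) = 0 := by
  ext i j; simp [euclMatrix_apply]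

theorem euclMatrix_smul (s : ℝ) (L : Eucl n →L[ℝ] Eucl n) :
    euclMatrix (s • L) = s • euclMatrix L := by
  ext i j; simp [euclMatrix_apply]

theorem symmInv_zero_right {k : ℕ} (hk : 1 ≤ k) : symmInv k (0 : Matrix (Fin n) (Fin n) ℝ) = 0 := by
  have := symmInv_smul k 0 (0 : Matrix (Fin n) (Fin n) ℝ)
  simpa [zero_pow (by omega : k ≠ 0)] using this

theorem symmInv_zero_left (A : Matrix (Fin n) (Fin n) ℝ) : symmInv 0 A = 1 := by
  simp [symmInv, genKronecker, Function.injective_of_subsingleton]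

/-- The `k`-Hessian-type expressions `S_k(DZ)` are null Lagrangians. -/
theorem integral_symmInv_fderiv_eq_zero {Z : Eucl n → Eucl n} (hZ : ContDiff ℝ 1 Z)
    (hsupp : HasCompactSupport Z) {k : ℕ} (hk : 1 ≤ k) (hkn : k ≤ n) :
    ∫ x, symmInv k (euclMatrix (fderiv ℝ Z x)) = 0 := by
  obtain ⟨K, hK⟩ := hZ.lipschitzWith_of_hasCompactSupport hsupp (by norm_num)
  obtain ⟨R, hR⟩ := hsupp.isCompact.isBounded.subset_closedBall (0 : Eucl n)
  set B := Metric.closedBall (0 : Eucl n) R with hB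
  have hcont : ∀ j, Continuous fun x => symmInv j (euclMatrix (fderiv ℝ Z x)) := fun j =>
    (continuous_symmInv j).comp (continuous_euclMatrix.comp (hZ.continuous_fderiv (by norm_num)))
  have hint : ∀ j, IntegrableOn (fun x => symmInv j (euclMatrix (fderiv ℝ Z x))) B := fun j =>
    (hcont j).continuousOn.integrableOn_compact (isCompact_closedBall _ _)
  have hoff : ∀ x ∉ B, symmInv k (euclMatrix (fderiv ℝ Z x)) = 0 := by
    intro x hx
    rw [fderiv_of_notMem_tsupport ℝ (fun h => hx (hR h)), euclMatrix_zero, symmInv_zero_right hk]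
  let c : ℕ → ℝ := fun j => ∫ x in B, symmInv j (euclMatrix (fderiv ℝ Z x))
  -- For small `s ≥ 0`, `∫ det(1 + s DZ)` over the ball is its volume, which is `c 0`. This
  -- polynomial in `s` thus has infinitely many roots, and its coefficients of positive degree are
  -- the integrals sought.
  let P : ℝ[X] := ∑ j ∈ Finset.range (n + 1), C (c j) * X ^ j - C (c 0)
  have heval : ∀ s : ℝ, 0 ≤ s → s * K < 1 → P.eval s = 0 := by
    intro s hs hsK
    have hlip : LipschitzWith (s.toNNReal * K) fun x => s • Z x := by
      refine LipschitzWith.of_dist_le_mul fun x y => ?_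
      rw [dist_smul₀, Real.norm_of_nonneg hs, NNReal.coe_mul, Real.coe_toNNReal s hs, mul_assoc]
      exact mul_le_mul_of_nonneg_left (hK.dist_le_mul x y) hs
    have h := setIntegral_det_id_add_fderiv (hZ.const_smul s) (c := s.toNNReal * K)
      (by rw [← NNReal.coe_lt_coe]; simpa [Real.coe_toNNReal s hs] using hsK) hlip (R := R)
      (fun x hx => by
        show s • Z x = 0
        rw [image_eq_zero_of_notMem_tsupport (fun h => hx (hR h)), smul_zero])
    have hfd : ∀ x, fderiv ℝ (fun x => s • Z x) x = s • fderiv ℝ Z x := fun x =>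
      fderiv_const_smul (hZ.differentiable (by norm_num) x) s
    change ∫ x in B, (1 + euclMatrix (fderiv ℝ (fun x => s • Z x) x)).det = volume.real B at h
    simp only [hfd, euclMatrix_smul, det_one_add_smul_eq_sum_symmInv] at h
    rw [integral_finsetSum _ (fun j _ => (hint j).mul_const _)] at h
    simp only [integral_mul_const] at h
    have hc0 : c 0 = volume.real B := by simp [c, symmInv_zero_left]
    simp only [P, eval_sub, eval_finsetSum, eval_mul, eval_C, eval_pow, eval_X, c]
    rw [h, ← hc0, sub_self]
  have hP : P = 0 := by
    refine eq_zero_of_infinite_isRoot P (Set.Infinite.mono ?_ (Ioo_infinite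
      (show (0 : ℝ) < 1 / (K + 1) by positivity)))
    intro s hs
    refine heval s hs.1.le ?_
    have := hs.2
    rw [lt_div_iff₀ (by positivity)] at this
    linarith [hs.1]
  have hck : c k = 0 := by
    have := congrArg (fun p => p.coeff k) hP
    simpa [P, coeff_C, show k ≠ 0 by omega, Nat.lt_succ_iff, hkn] using this
  rw [← setIntegral_eq_integral_of_forall_compl_eq_zero hoff]
  exact hck

end NullLagrangian

/-! ### Test fields `θ(u) V(∇u)` -/

section TestFields

open Matrix Filter Topology Set

variable {n : ℕ} {Ω : Set (Eucl n)} {u : Eucl n → ℝ}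

theorem isCompact_inter_le_abs (hΩb : Bornology.IsBounded Ω) (huc : ContinuousOn u (closure Ω))
    (ε : ℝ) : IsCompact (closure Ω ∩ {x | ε ≤ |u x|}) :=
  hΩb.isCompact_closure.of_isClosed_subset
    (huc.abs.preimage_isClosed_of_isClosed isClosed_closure isClosed_Ici) inter_subset_left

theorem inter_le_abs_subset (hΩo : IsOpen Ω) (hu0 : ∀ x ∈ frontier Ω, u x = 0) {ε : ℝ}
    (hε : 0 < ε) : closure Ω ∩ {x | ε ≤ |u x|} ⊆ Ω := by
  rintro x ⟨hx, hxu⟩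
  by_contra h
  have := hu0 x ⟨hx, by rwa [hΩo.interior_eq]⟩
  simp only [mem_ofPred_eq, this, abs_zero] at hxu
  linarith

theorem contDiff_indicator_of_eqOn_zero {G : Type*} [NormedAddCommGroup G] [NormedSpace ℝ G]
    {f : Eucl n → G} {K : Set (Eucl n)} (hΩo : IsOpen Ω) (hK : IsClosed K)
    (hKΩ : K ⊆ Ω) (hf : ∀ x ∈ Ω, ContDiffAt ℝ 1 f x) (h0 : ∀ x ∈ Ω, x ∉ K → f x = 0) :
    ContDiff ℝ 1 (Ω.indicator f) := by
  rw [contDiff_iff_contDiffAt]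
  intro x
  by_cases hx : x ∈ Ω
  · refine (hf x hx).congr_of_eventuallyEq ?_
    filter_upwards [hΩo.mem_nhds hx] with y hy
    exact indicator_of_mem hy f
  · refine (contDiffAt_const (c := (0 : G))).congr_of_eventuallyEq ?_
    filter_upwards [hK.isOpen_compl.mem_nhds (fun h => hx (hKΩ h))] with y hy
    by_cases hyΩ : y ∈ Ω
    · rw [indicator_of_mem hyΩ, h0 y hyΩ hy]
    · exact indicator_of_notMem hyΩ f

/-- A `C¹` nonnegative function of one variable that vanishes near the origin. -/
structure IsTestProfile (θ : ℝ → ℝ) (ε : ℝ) : Prop where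
  contDiff : ContDiff ℝ 1 θ
  nonneg : ∀ s, 0 ≤ θ s
  pos : 0 < ε
  eq_zero : ∀ s, |s| < ε → θ s = 0

namespace IsTestProfile

variable {θ : ℝ → ℝ} {ε : ℝ}

theorem deriv_eq_zero_of_eq_zero (hθ : IsTestProfile θ ε) {s : ℝ} (hs : θ s = 0) :
    deriv θ s = 0 := by
  have : IsLocalMin θ s := Eventually.of_forall fun t => by rw [hs]; exact hθ.nonneg t
  exact this.deriv_eq_zero

theorem deriv_pow (hθ : IsTestProfile θ ε) (k : ℕ) (s : ℝ) :
    deriv (fun s => θ s ^ k) s = k * θ s ^ (k - 1) * deriv θ s :=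
  deriv_fun_pow (hθ.contDiff.differentiable (by norm_num) s) k

theorem deriv_pow_eq_zero (hθ : IsTestProfile θ ε) (k : ℕ) {s : ℝ} (hs : |s| < ε) :
    deriv (fun s => θ s ^ k) s = 0 := by
  rw [hθ.deriv_pow, hθ.deriv_eq_zero_of_eq_zero (hθ.eq_zero s hs), mul_zero]

theorem continuous_deriv_pow (hθ : IsTestProfile θ ε) (k : ℕ) :
    Continuous (deriv (fun s => θ s ^ k)) :=
  (hθ.contDiff.pow k).continuous_deriv le_rfl

end IsTestProfile

theorem contDiffAt_gradient_of_contDiffOn (hΩo : IsOpen Ω) (hu : ContDiffOn ℝ 2 u Ω)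
    {x : Eucl n} (hx : x ∈ Ω) : ContDiffAt ℝ 1 (gradient u) x :=
  (hu.contDiffAt (hΩo.mem_nhds hx)).gradient (by norm_num)

/-- The increment carries `θ^(k-1) θ'`, which is `(θ^k)' / k`. Where `θ` vanishes the scaling rule
is unavailable, but `θ'` vanishes too, since `θ ≥ 0` has a minimum there. -/
theorem symmInv_euclMatrix_smul_add {θ : ℝ → ℝ} {ε : ℝ} (hθ : IsTestProfile θ ε) {k : ℕ}
    (hk : 1 ≤ k) (s : ℝ) (A : Matrix (Fin n) (Fin n) ℝ) (a b : Fin n → ℝ) :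
    symmInv k (θ s • A + vecMulVec (deriv θ s • a) b) =
      θ s ^ k * symmInv k A +
        1 / (k : ℝ) * deriv (fun s => θ s ^ k) s * rankOneIncrement k A a b := by
  have hk0 : (k : ℝ) ≠ 0 := by positivity
  rw [symmInv_add_vecMulVec, rankOneIncrement_smul_left, symmInv_smul, hθ.deriv_pow]
  by_cases h : θ s = 0
  · rw [hθ.deriv_eq_zero_of_eq_zero h]
    ring
  · obtain ⟨l, rfl⟩ : ∃ l, k = l + 1 := ⟨k - 1, by omega⟩
    rw [rankOneIncrement_smul _ h, Nat.add_sub_cancel, pow_succ]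
    field_simp

/-- Since `u = 0` on the boundary and `θ` vanishes near 0, the field `θ(u) V(∇u)`, extended by zero,
is `C¹` with compact support in `Ω`. The integrand is `S_k` of its derivative. -/
theorem integral_testField_eq_zero (hΩo : IsOpen Ω) (hΩb : Bornology.IsBounded Ω)
    (hu : ContDiffOn ℝ 2 u Ω) (huc : ContinuousOn u (closure Ω))
    (hu0 : ∀ x ∈ frontier Ω, u x = 0) {V : Eucl n → Eucl n} (hV : ContDiff ℝ 1 V)
    {θ : ℝ → ℝ} {ε : ℝ} (hθ : IsTestProfile θ ε) {k : ℕ} (hk : 1 ≤ k) (hkn : k ≤ n) :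
    ∫ x in Ω, (θ (u x) ^ k *
        symmInv k (euclMatrix (fderiv ℝ V (gradient u x) ∘L fderiv ℝ (gradient u) x)) +
      1 / (k : ℝ) * deriv (fun s => θ s ^ k) (u x) *
        rankOneIncrement k (euclMatrix (fderiv ℝ V (gradient u x) ∘L fderiv ℝ (gradient u) x))
          (V (gradient u x)).ofLp (gradient u x).ofLp) = 0 := by
  set f : Eucl n → Eucl n := fun x => θ (u x) • V (gradient u x) with hf
  set K := closure Ω ∩ {x | ε ≤ |u x|} with hK
  have hKc : IsCompact K := isCompact_inter_le_abs hΩb huc ε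
  have hKΩ : K ⊆ Ω := inter_le_abs_subset hΩo hu0 hθ.pos
  have h0 : ∀ x ∈ Ω, x ∉ K → f x = 0 := by
    intro x hx hxK
    have : |u x| < ε := by
      by_contra! h
      exact hxK ⟨subset_closure hx, h⟩
    simp [hf, hθ.eq_zero _ this]
  have hZ : ContDiff ℝ 1 (Ω.indicator f) := by
    refine contDiff_indicator_of_eqOn_zero hΩo hKc.isClosed hKΩ (fun x hx => ?_) h0
    have hux : ContDiffAt ℝ 1 u x := (hu.contDiffAt (hΩo.mem_nhds hx)).of_le (by norm_num)
    exact (hθ.contDiff.contDiffAt.comp x hux).smul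
      (hV.contDiffAt.comp x (contDiffAt_gradient_of_contDiffOn hΩo hu hx))
  have hZ0 : ∀ x ∉ K, Ω.indicator f x = 0 := by
    intro x hx
    by_cases hxΩ : x ∈ Ω
    · rw [indicator_of_mem hxΩ, h0 x hxΩ hx]
    · exact indicator_of_notMem hxΩ f
  have hint := integral_symmInv_fderiv_eq_zero hZ (HasCompactSupport.intro hKc hZ0) hk hkn
  have hoff : ∀ x ∉ Ω, symmInv k (euclMatrix (fderiv ℝ (Ω.indicator f) x)) = 0 := by
    intro x hx
    have : Ω.indicator f =ᶠ[𝓝 x] fun _ => 0 := by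
      filter_upwards [hKc.isClosed.isOpen_compl.mem_nhds (fun h => hx (hKΩ h))] with y hy
      exact hZ0 y hy
    rw [this.fderiv_eq, fderiv_fun_const, Pi.zero_apply, euclMatrix_zero, symmInv_zero_right hk]
  rw [← setIntegral_eq_integral_of_forall_compl_eq_zero hoff] at hint
  rw [← hint]
  refine setIntegral_congr_fun hΩo.measurableSet fun x hx => ?_
  have hev : Ω.indicator f =ᶠ[𝓝 x] f := by
    filter_upwards [hΩo.mem_nhds hx] with y hy
    exact indicator_of_mem hy f
  have hux : HasFDerivAt u (fderiv ℝ u x) x :=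
    ((hu.contDiffAt (hΩo.mem_nhds hx)).differentiableAt (by norm_num)).hasFDerivAt
  have hθx : HasDerivAt θ (deriv θ (u x)) (u x) :=
    (hθ.contDiff.differentiable (by norm_num) _).hasDerivAt
  have hVx : HasFDerivAt (fun y => V (gradient u y))
      (fderiv ℝ V (gradient u x) ∘L fderiv ℝ (gradient u) x) x :=
    HasFDerivAt.comp x (hV.differentiable (by norm_num) _).hasFDerivAt
      ((contDiffAt_gradient_of_contDiffOn hΩo hu hx).differentiableAt (by norm_num)).hasFDerivAt
  have hfd : HasFDerivAt f _ x := (hθx.comp_hasFDerivAt x hux).smul hVx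
  have hmat : euclMatrix (fderiv ℝ f x) =
      θ (u x) • euclMatrix (fderiv ℝ V (gradient u x) ∘L fderiv ℝ (gradient u) x) +
        vecMulVec (deriv θ (u x) • (V (gradient u x)).ofLp) (gradient u x).ofLp := by
    rw [hfd.fderiv]
    ext i j
    have : fderiv ℝ u x (EuclideanSpace.single j 1) = gradient u x j := by
      rw [← inner_gradient_left, EuclideanSpace.inner_single_right]
      simp
    simp [euclMatrix_apply, vecMulVec_apply, this]
    ring
  simp only []
  rw [hev.fderiv_eq, hmat, symmInv_euclMatrix_smul_add hθ hk]

end TestFields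

/-! ### Regularization of `∇(F²/2)` at the origin -/

section Regularization

open Matrix Filter Topology Set

variable {n : ℕ} {F : Eucl n → ℝ}

namespace IsStronglyConvexNorm

theorem gradient_half_sq_smul (hF : IsStronglyConvexNorm F) {ξ : Eucl n} (hξ : ξ ≠ 0) {t : ℝ}
    (ht : 0 < t) : gradient (fun η => (1 / 2 : ℝ) * F η ^ 2) (t • ξ) =
      t • gradient (fun η => (1 / 2 : ℝ) * F η ^ 2) ξ := by
  rw [hF.gradient_half_sq hξ, hF.gradient_half_sq (smul_ne_zero ht.ne' hξ), hF.gradient_smul hξ ht,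
    hF.map_smul t ξ ht.le, mul_smul]

theorem fderiv_gradient_half_sq_smul (hF : IsStronglyConvexNorm F) {ξ : Eucl n} (hξ : ξ ≠ 0) {t : ℝ}
    (ht : 0 < t) : fderiv ℝ (gradient (fun η => (1 / 2 : ℝ) * F η ^ 2)) (t • ξ) =
      fderiv ℝ (gradient (fun η => (1 / 2 : ℝ) * F η ^ 2)) ξ := by
  set V := gradient (fun η => (1 / 2 : ℝ) * F η ^ 2) with hV
  have hd : ∀ {η : Eucl n}, η ≠ 0 → HasFDerivAt V (fderiv ℝ V η) η := fun hη =>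
    ((hF.contDiffAt_gradient_half_sq hη).differentiableAt (by norm_num)).hasFDerivAt
  have h1 := (hd (smul_ne_zero ht.ne' hξ)).comp ξ ((hasFDerivAt_id ξ).const_smul t)
  have h2 := (hd hξ).const_smul t
  have h3 : V ∘ HSMul.hSMul t =ᶠ[𝓝 ξ] t • V := by
    filter_upwards [isOpen_compl_singleton.mem_nhds hξ] with η hη
    exact hF.gradient_half_sq_smul hη ht
  ext1 v
  have h4 := congrArg (fun T => T v) (h1.unique (h2.congr_of_eventuallyEq h3))
  simp only [ContinuousLinearMap.comp_apply, _root_.smul_apply, ContinuousLinearMap.id_apply,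
    _root_.map_smul] at h4
  exact smul_right_injective _ ht.ne' h4

/-- The gradient of `F²/2`, cut off near the origin. -/
def truncatedGradient (F : Eucl n → ℝ) (ξ : Eucl n) : Eucl n :=
  Real.smoothTransition (2 * ‖ξ‖ ^ 2 - 1) • gradient (fun η => (1 / 2 : ℝ) * F η ^ 2) ξ

theorem truncatedGradient_eventuallyEq_zero :
    truncatedGradient F =ᶠ[𝓝 0] fun _ => 0 := by
  have : ∀ᶠ ξ : Eucl n in 𝓝 0, 2 * ‖ξ‖ ^ 2 - 1 < 0 := by
    refine ContinuousAt.eventually_lt (f := fun ξ : Eucl n => 2 * ‖ξ‖ ^ 2 - 1) (g := fun _ => 0)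
      (by fun_prop) (by fun_prop) (by simp)
  filter_upwards [this] with ξ hξ
  rw [truncatedGradient, Real.smoothTransition.zero_of_nonpos hξ.le, zero_smul]

theorem truncatedGradient_of_one_le {ξ : Eucl n} (hξ : 1 ≤ ‖ξ‖) :
    truncatedGradient F ξ = gradient (fun η => (1 / 2 : ℝ) * F η ^ 2) ξ := by
  rw [truncatedGradient, Real.smoothTransition.one_of_one_le (by nlinarith), one_smul]

theorem truncatedGradient_eventuallyEq {ξ : Eucl n} (hξ : 1 < ‖ξ‖) :
    truncatedGradient F =ᶠ[𝓝 ξ] gradient (fun η => (1 / 2 : ℝ) * F η ^ 2) := by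
  filter_upwards [continuous_norm.continuousAt.eventually (lt_mem_nhds hξ)] with η hη
  exact truncatedGradient_of_one_le hη.le

theorem contDiff_truncatedGradient (hF : IsStronglyConvexNorm F) :
    ContDiff ℝ 1 (truncatedGradient F) := by
  rw [contDiff_iff_contDiffAt]
  intro ξ
  by_cases hξ : ξ = 0
  · rw [hξ]
    exact contDiffAt_const.congr_of_eventuallyEq truncatedGradient_eventuallyEq_zero
  · have h1 : ContDiffAt ℝ 1 (fun ξ : Eucl n => Real.smoothTransition (2 * ‖ξ‖ ^ 2 - 1)) ξ :=
      (Real.smoothTransition.contDiff (n := 1)).contDiffAt.comp ξ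
        ((contDiffAt_const.mul (contDiffAt_id.norm_sq ℝ)).sub contDiffAt_const)
    exact h1.smul ((hF.contDiffAt_gradient_half_sq hξ).of_le one_le_two)

/-- The derivative of `∇(F²/2)` is 0-homogeneous, so its values far out already occur on the sphere
of radius 2, where the cutoff is inactive; compactness bounds the rest. -/
theorem exists_norm_fderiv_truncatedGradient_le (hF : IsStronglyConvexNorm F) :
    ∃ C : ℝ, ∀ ξ, ‖fderiv ℝ (truncatedGradient F) ξ‖ ≤ C := by
  obtain ⟨C, hC⟩ := (isCompact_closedBall (0 : Eucl n) 2).exists_bound_of_continuousOn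
    ((hF.contDiff_truncatedGradient.continuous_fderiv (by norm_num)).continuousOn)
  refine ⟨C, fun ξ => ?_⟩
  by_cases hξ : ‖ξ‖ ≤ 2
  · exact hC ξ (by simpa using hξ)
  · push Not at hξ
    have h0 : ξ ≠ 0 := by rintro rfl; simp at hξ; linarith
    have hpos : 0 < ‖ξ‖ := norm_pos_iff.2 h0
    have hn : ‖(2 / ‖ξ‖) • ξ‖ = 2 := by
      rw [norm_smul, Real.norm_of_nonneg (by positivity)]; field_simp
    have h := hC ((2 / ‖ξ‖) • ξ) (by simp [hn])
    rwa [(truncatedGradient_eventuallyEq (by rw [hn]; norm_num)).fderiv_eq,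
      hF.fderiv_gradient_half_sq_smul h0 (by positivity),
      ← (truncatedGradient_eventuallyEq (by linarith)).fderiv_eq] at h

/-- The scaling `t⁻¹ V(t ξ)` shrinks the cutoff region without enlarging the derivative, which is
what keeps the bound uniform in `t`. -/
theorem hasFDerivAt_rescaled_truncatedGradient (hF : IsStronglyConvexNorm F) {t : ℝ} (ht : 0 < t)
    (ξ : Eucl n) : HasFDerivAt (fun ξ => t⁻¹ • truncatedGradient F (t • ξ))
      (fderiv ℝ (truncatedGradient F) (t • ξ)) ξ := by
  have h := ((hF.contDiff_truncatedGradient.differentiable (by norm_num) _).hasFDerivAt.comp ξ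
    ((hasFDerivAt_id ξ).const_smul t)).const_smul t⁻¹
  have he : fderiv ℝ (truncatedGradient F) (t • ξ) =
      t⁻¹ • (fderiv ℝ (truncatedGradient F) (t • id ξ) ∘L (t • ContinuousLinearMap.id ℝ (Eucl n))) := by
    ext1 v
    simp [smul_smul, inv_mul_cancel₀ ht.ne']
  rw [he]
  exact h

end IsStronglyConvexNorm

theorem newtonEnergy_eq_rankOneIncrement (k : ℕ) (F u : Eucl n → ℝ) (x : Eucl n) :
    newtonEnergy k F u x = rankOneIncrement k (anisoHessian F u x)
      (F (gradient u x) • gradient F (gradient u x)).ofLp (gradient u x).ofLp := by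
  rw [← sum_newton_mul_mul, newtonEnergy]
  exact Finset.sum_congr rfl fun i _ => Finset.sum_congr rfl fun j _ => by
    simp only [PiLp.smul_apply, smul_eq_mul]; ring

theorem gradient_half_norm_sq (ξ : Eucl n) :
    gradient (fun η : Eucl n => (1 / 2 : ℝ) * ‖η‖ ^ 2) ξ = ξ := by
  refine ext_inner_right ℝ fun v => ?_
  have h := ((hasStrictFDerivAt_norm_sq ξ).hasFDerivAt).const_mul (1 / 2 : ℝ)
  rw [inner_gradient_left, h.fderiv]
  simp

/-- The vector field `∇(F²/2)` is approximated by `C¹` fields with uniformly bounded derivatives, in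
such a way that the expressions built from the Hessian of `u` are eventually exact. -/
theorem exists_regularization (hF : IsStronglyConvexNorm F) (k : ℕ) :
    ∃ V : ℕ → Eucl n → Eucl n, (∀ j, ContDiff ℝ 1 (V j)) ∧ (∀ j, V j 0 = 0) ∧
      (∃ C : ℝ, ∀ j ξ, ‖fderiv ℝ (V j) ξ‖ ≤ C) ∧
      ∀ (u : Eucl n → ℝ) (x : Eucl n), ContDiffAt ℝ 2 u x → ∀ᶠ j in atTop,
        euclMatrix (fderiv ℝ (V j) (gradient u x) ∘L fderiv ℝ (gradient u) x) =
          anisoHessian F u x ∧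
        rankOneIncrement k (anisoHessian F u x) (V j (gradient u x)).ofLp (gradient u x).ofLp =
          newtonEnergy k F u x := by
  -- For the Euclidean norm the field is the identity and the Hessian keeps its true value at
  -- critical points. Otherwise the truncated fields are constant near 0, which reproduces the
  -- convention `A_F[u] = 0` there.
  by_cases hE : F = fun ξ => ‖ξ‖
  · refine ⟨fun _ => id, fun _ => contDiff_id, fun _ => rfl, ⟨1, fun j ξ => ?_⟩, fun u x hu => ?_⟩
    · rw [fderiv_id]; exact ContinuousLinearMap.norm_id_le
    · refine Eventually.of_forall fun j => ?_
      have hd : HasFDerivAt (gradient u) (fderiv ℝ (gradient u) x) x :=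
        ((hu.gradient (m := 1) (by norm_num)).differentiableAt (by norm_num)).hasFDerivAt
      have hg : (fun y => gradient (fun ξ => (1 / 2 : ℝ) * F ξ ^ 2) (gradient u y)) =
          gradient u := by
        ext1 y; rw [hE, gradient_half_norm_sq]
      constructor
      · rw [anisoHessian_of_differentiableAt (fun h => h.2 hE) (by rw [hg]; exact hd.differentiableAt),
          hg, fderiv_id, ContinuousLinearMap.id_comp]
      · by_cases hx : gradient u x = 0
        · rw [newtonEnergy_of_gradient_eq_zero hx, hx]
          exact rankOneIncrement_zero_right _ _ _
        · rw [newtonEnergy_eq_rankOneIncrement, ← hF.gradient_half_sq hx]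
          rw [hE, gradient_half_norm_sq]
          rfl
  · have ht : ∀ j : ℕ, (0 : ℝ) < j + 1 := fun j => by positivity
    have hd := fun (j : ℕ) ξ => hF.hasFDerivAt_rescaled_truncatedGradient (ht j) ξ
    have h00 : IsStronglyConvexNorm.truncatedGradient F 0 = 0 :=
      IsStronglyConvexNorm.truncatedGradient_eventuallyEq_zero.eq_of_nhds
    obtain ⟨C, hC⟩ := hF.exists_norm_fderiv_truncatedGradient_le
    refine ⟨fun j ξ => (j + 1 : ℝ)⁻¹ • IsStronglyConvexNorm.truncatedGradient F ((j + 1 : ℝ) • ξ),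
      fun j => ?_, fun j => ?_, ⟨C, fun j ξ => ?_⟩, fun u x hu => ?_⟩
    · exact (hF.contDiff_truncatedGradient.comp (contDiff_id.const_smul _)).const_smul _
    · simp [h00]
    · rw [(hd j ξ).fderiv]; exact hC _
    · by_cases hx : gradient u x = 0
      · refine Eventually.of_forall fun j => ⟨?_, ?_⟩
        · rw [(hd j _).fderiv, hx, smul_zero,
            IsStronglyConvexNorm.truncatedGradient_eventuallyEq_zero.fderiv_eq, anisoHessian,
            if_pos ⟨hx, hE⟩]
          ext i j
          simp [euclMatrix_apply]
        · rw [newtonEnergy_of_gradient_eq_zero hx, hx]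
          exact rankOneIncrement_zero_right _ _ _
      · have hpos : 0 < ‖gradient u x‖ := norm_pos_iff.2 hx
        obtain ⟨N, hN⟩ := exists_nat_gt (1 / ‖gradient u x‖)
        filter_upwards [eventually_ge_atTop N] with j hj
        have hj1 : 1 < ‖(j + 1 : ℝ) • gradient u x‖ := by
          rw [norm_smul, Real.norm_of_nonneg (ht j).le]
          rw [div_lt_iff₀ hpos] at hN
          have : (N : ℝ) ≤ j := by exact_mod_cast hj
          nlinarith
        constructor
        · rw [(hd j _).fderiv,
            (IsStronglyConvexNorm.truncatedGradient_eventuallyEq hj1).fderiv_eq,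
            hF.fderiv_gradient_half_sq_smul hx (ht j), ← hF.anisoHessian_eq_euclMatrix hu hx]
        · rw [newtonEnergy_eq_rankOneIncrement,
            IsStronglyConvexNorm.truncatedGradient_of_one_le hj1.le,
            hF.gradient_half_sq_smul hx (ht j), smul_smul, inv_mul_cancel₀ (ht j).ne', one_smul,
            hF.gradient_half_sq hx]

end Regularization

/-! ### Passage to the limit in the test fields and in the profiles -/

section Limits

open Matrix Filter Topology Set

variable {n : ℕ} {Ω : Set (Eucl n)} {F u : Eucl n → ℝ}

theorem continuous_rankOneIncrement (k : ℕ) :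
    Continuous fun p : Matrix (Fin n) (Fin n) ℝ × (Fin n → ℝ) × (Fin n → ℝ) =>
      rankOneIncrement k p.1 p.2.1 p.2.2 := by
  have h : ∀ p : Matrix (Fin n) (Fin n) ℝ × (Fin n → ℝ) × (Fin n → ℝ),
      rankOneIncrement k p.1 p.2.1 p.2.2 =
        symmInv k (p.1 + vecMulVec p.2.1 p.2.2) - symmInv k p.1 := fun p => by
    rw [symmInv_add_vecMulVec]; ring
  simp only [h]
  have hv : Continuous fun p : Matrix (Fin n) (Fin n) ℝ × (Fin n → ℝ) × (Fin n → ℝ) =>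
      p.1 + vecMulVec p.2.1 p.2.2 := by
    refine continuous_matrix fun i j => ?_
    simp only [Matrix.add_apply, vecMulVec_apply]
    fun_prop
  exact ((continuous_symmInv k).comp hv).sub ((continuous_symmInv k).comp continuous_fst)

/-- The integrand of `integral_testField_eq_zero` as a function of the 2-jet. -/
def testIntegrand (k : ℕ) (θ : ℝ → ℝ) (p : ℝ × (Eucl n →L[ℝ] Eucl n) × Eucl n × Eucl n) : ℝ :=
  θ p.1 ^ k * symmInv k (euclMatrix p.2.1) +
    1 / (k : ℝ) * deriv (fun s => θ s ^ k) p.1 *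
      rankOneIncrement k (euclMatrix p.2.1) p.2.2.1.ofLp p.2.2.2.ofLp

theorem continuous_testIntegrand (k : ℕ) {θ : ℝ → ℝ} {ε : ℝ} (hθ : IsTestProfile θ ε) :
    Continuous (testIntegrand (n := n) k θ) := by
  have h1 := hθ.contDiff.continuous
  have h2 := hθ.continuous_deriv_pow k
  have h3 : Continuous fun p : ℝ × (Eucl n →L[ℝ] Eucl n) × Eucl n × Eucl n =>
      euclMatrix p.2.1 := continuous_euclMatrix.comp (by fun_prop)
  have h4 := (continuous_symmInv k).comp h3
  have h5 : Continuous fun p : ℝ × (Eucl n →L[ℝ] Eucl n) × Eucl n × Eucl n =>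
      (euclMatrix p.2.1, p.2.2.1.ofLp, p.2.2.2.ofLp) := by fun_prop
  have h6 := (continuous_rankOneIncrement k).comp h5
  exact (((h1.comp continuous_fst).pow k).mul h4).add
    ((continuous_const.mul (h2.comp continuous_fst)).mul h6)

/-- Dominated convergence in the regularization: the integrands live on the compact set `{|u| ≥ ε}`,
where all jets stay in one fixed ball, and at each point they are eventually equal to the limit. -/
theorem integral_profile_eq_zero (hF : IsStronglyConvexNorm F) (hΩo : IsOpen Ω)
    (hΩb : Bornology.IsBounded Ω)
    (hu : ContDiffOn ℝ 2 u Ω) (huc : ContinuousOn u (closure Ω))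
    (hu0 : ∀ x ∈ frontier Ω, u x = 0)
    {θ : ℝ → ℝ} {ε : ℝ} (hθ : IsTestProfile θ ε) {k : ℕ} (hk : 1 ≤ k) (hkn : k ≤ n) :
    ∫ x in Ω, (θ (u x) ^ k * anisoHessianOp k F u x +
      1 / (k : ℝ) * deriv (fun s => θ s ^ k) (u x) * newtonEnergy k F u x) = 0 := by
  obtain ⟨V, hV, hV0, ⟨C, hC⟩, hlim⟩ := exists_regularization hF k
  set K := closure Ω ∩ {x | ε ≤ |u x|} with hK
  have hKc : IsCompact K := isCompact_inter_le_abs hΩb huc ε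
  have hKΩ : K ⊆ Ω := inter_le_abs_subset hΩo hu0 hθ.pos
  have hg : ContinuousOn (gradient u) Ω := fun x hx =>
    (contDiffAt_gradient_of_contDiffOn hΩo hu hx).continuousAt.continuousWithinAt
  have hH : ContinuousOn (fderiv ℝ (gradient u)) Ω := fun x hx =>
    ((contDiffAt_gradient_of_contDiffOn hΩo hu hx).continuousAt_fderiv
      (by norm_num)).continuousWithinAt
  obtain ⟨C0, hC0⟩ := hKc.exists_bound_of_continuousOn (huc.mono inter_subset_left)
  obtain ⟨C1, hC1⟩ := hKc.exists_bound_of_continuousOn (hg.mono hKΩ)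
  obtain ⟨C2, hC2⟩ := hKc.exists_bound_of_continuousOn (hH.mono hKΩ)
  let jet : ℕ → Eucl n → ℝ × (Eucl n →L[ℝ] Eucl n) × Eucl n × Eucl n := fun j x =>
    (u x, fderiv ℝ (V j) (gradient u x) ∘L fderiv ℝ (gradient u) x, V j (gradient u x),
      gradient u x)
  have hjet : ∀ j, ContinuousOn (jet j) Ω := fun j =>
    (huc.mono subset_closure).prodMk (((((hV j).continuous_fderiv (by norm_num)).comp_continuousOn
      hg).clm_comp hH).prodMk (((hV j).continuous.comp_continuousOn hg).prodMk hg))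
  have hC' : 0 ≤ C := (norm_nonneg _).trans (hC 0 0)
  have hVb : ∀ j ξ, ‖V j ξ‖ ≤ C * ‖ξ‖ := fun j ξ => by
    have := convex_univ.norm_image_sub_le_of_norm_fderiv_le (𝕜 := ℝ) (f := V j) (C := C)
      (fun x _ => (hV j).differentiable (by norm_num) x) (fun x _ => hC j x) (mem_univ 0)
      (mem_univ ξ)
    simpa [hV0] using this
  obtain ⟨B, hB⟩ := (isCompact_closedBall
    (0 : ℝ × (Eucl n →L[ℝ] Eucl n) × Eucl n × Eucl n)
      (max C0 (max (C * C2) (max (C * C1) C1)))).exists_bound_of_continuousOn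
      (continuous_testIntegrand k hθ).continuousOn
  have hbound : ∀ j, ∀ x ∈ Ω, ‖testIntegrand k θ (jet j x)‖ ≤ K.indicator (fun _ => B) x := by
    intro j x hx
    by_cases hxK : x ∈ K
    · rw [indicator_of_mem hxK]
      refine hB _ ?_
      rw [mem_closedBall_zero_iff]
      refine max_le_max (hC0 x hxK) (max_le_max ?_ (max_le_max ?_ (hC1 x hxK)))
      · exact (ContinuousLinearMap.opNorm_comp_le _ _).trans
          (mul_le_mul (hC j _) (hC2 x hxK) (norm_nonneg _) hC')
      · exact (hVb j _).trans (mul_le_mul_of_nonneg_left (hC1 x hxK) hC')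
    · have : |u x| < ε := by
        by_contra! h
        exact hxK ⟨subset_closure hx, h⟩
      rw [indicator_of_notMem hxK]
      simp only [testIntegrand, jet, hθ.eq_zero _ this, hθ.deriv_pow_eq_zero k this]
      rw [zero_pow (by omega)]
      simp
  have hae : ∀ᵐ x ∂(volume.restrict Ω), x ∈ Ω := ae_restrict_mem hΩo.measurableSet
  have htend := tendsto_integral_of_dominated_convergence (μ := volume.restrict Ω)
    (F := fun j x => testIntegrand k θ (jet j x))
    (f := fun x => θ (u x) ^ k * anisoHessianOp k F u x +
      1 / (k : ℝ) * deriv (fun s => θ s ^ k) (u x) * newtonEnergy k F u x)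
    (K.indicator fun _ => B)
    (fun j => (((continuous_testIntegrand k hθ).comp_continuousOn
      (hjet j)).aestronglyMeasurable hΩo.measurableSet))
    (((integrable_indicator_iff hKc.measurableSet).2
      (integrableOn_const hKc.measure_lt_top.ne)).mono_measure Measure.restrict_le_self)
    (fun j => hae.mono fun x hx => hbound j x hx)
    (hae.mono fun x hx => by
      refine tendsto_const_nhds.congr' ?_
      filter_upwards [hlim u x (hu.contDiffAt (hΩo.mem_nhds hx))] with j hj
      simp only [testIntegrand, jet, hj.1, hj.2, anisoHessianOp])
  refine tendsto_nhds_unique htend ?_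
  have h0 : ∀ j, ∫ x in Ω, testIntegrand k θ (jet j x) = 0 := fun j =>
    integral_testField_eq_zero hΩo hΩb hu huc hu0 (hV j) hθ hk hkn
  simp only [h0]
  exact tendsto_const_nhds

/-- A profile whose `k`-th power is a smooth approximation of the positive part. -/
theorem exists_profile {k : ℕ} (hk : 1 ≤ k) :
    ∃ θ : ℝ → ℝ, ContDiff ℝ 1 θ ∧ (∀ s, 0 ≤ θ s) ∧ (∀ s ≤ 1, θ s = 0) ∧
      (∀ s, 2 ≤ s → θ s ^ k = s) ∧ ∀ s, θ s ^ k ≤ |s| := by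
  have hk0 : k ≠ 0 := by omega
  have hpow : ∀ s : ℝ, 1 ≤ s → (s ^ ((k : ℝ)⁻¹)) ^ k = s := fun s hs =>
    Real.rpow_inv_natCast_pow (by linarith) hk0
  have h0 : ∀ s : ℝ, s ≤ 1 → Real.smoothTransition (s - 1) * s ^ ((k : ℝ)⁻¹) = 0 := fun s hs => by
    rw [Real.smoothTransition.zero_of_nonpos (by linarith), zero_mul]
  -- The `k`-th root makes `θ^k` equal to `s` for `s ≥ 2`; the cutoff removes the singularity of the
  -- root at 0 and gives the required vanishing near 0.
  refine ⟨fun s => Real.smoothTransition (s - 1) * s ^ ((k : ℝ)⁻¹), ?_, ?_, h0, ?_, ?_⟩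
  · rw [contDiff_iff_contDiffAt]
    intro s
    by_cases hs : s < 1
    · refine (contDiffAt_const (c := (0 : ℝ))).congr_of_eventuallyEq ?_
      filter_upwards [Iio_mem_nhds hs] with t ht using h0 t ht.le
    · have hs0 : s ≠ 0 := by rintro rfl; exact hs one_pos
      have h1 : ContDiffAt ℝ 1 (fun s : ℝ => Real.smoothTransition (s - 1)) s :=
        (Real.smoothTransition.contDiff (n := 1)).contDiffAt.comp s
          (contDiffAt_id.sub contDiffAt_const)
      exact h1.mul (contDiffAt_id.rpow_const_of_ne hs0)
  · intro s
    by_cases hs : s ≤ 1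
    · exact (h0 s hs).ge
    · exact mul_nonneg (Real.smoothTransition.nonneg _) (Real.rpow_nonneg (by linarith) _)
  · intro s hs
    simp only [Real.smoothTransition.one_of_one_le (show 1 ≤ s - 1 by linarith), one_mul]
    exact hpow s (by linarith)
  · intro s
    by_cases hs : s ≤ 1
    · simp only [h0 s hs, zero_pow hk0]; exact abs_nonneg s
    · push Not at hs
      rw [mul_pow, hpow s hs.le, abs_of_pos (by linarith)]
      exact mul_le_of_le_one_left (by linarith)
        (pow_le_one₀ (Real.smoothTransition.nonneg _) (Real.smoothTransition.le_one _))

/-- As `t → ∞`, `g(t w)/t` tends to the positive part of `w` and `g'(t w)` to the indicator of `{w >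
0}`. The bound `|g(t w)/t| ≤ |w|` yields the majorant `|w S|`, so `S` itself need not be integrable.
-/
theorem integral_posPart_eq_zero {α : Type*} [MeasurableSpace α] {μ : Measure α} {g : ℝ → ℝ}
    (hg : ContDiff ℝ 1 g) (hg0 : ∀ s ≤ 1, g s = 0) (hg1 : ∀ s, 2 ≤ s → g s = s)
    (hgb : ∀ s, |g s| ≤ |s|) {w S N : α → ℝ} {c : ℝ} (hw : AEStronglyMeasurable w μ)
    (hS : Integrable (fun x => w x * S x) μ) (hN : Integrable N μ)
    (h : ∀ t : ℝ, 0 < t → ∫ x, (t⁻¹ * g (t * w x) * S x + c * deriv g (t * w x) * N x) ∂μ = 0) :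
    ∫ x, ((max (w x) 0) * S x + c * ({x | 0 < w x}.indicator N x)) ∂μ = 0 := by
  have hd0 : ∀ s < 1, deriv g s = 0 := fun s hs => by
    have : g =ᶠ[𝓝 s] fun _ => 0 := by
      filter_upwards [Iio_mem_nhds hs] with t ht using hg0 t ht.le
    rw [this.deriv_eq, deriv_const]
  have hd1 : ∀ s, 2 < s → deriv g s = 1 := fun s hs => by
    have : g =ᶠ[𝓝 s] id := by
      filter_upwards [Ioi_mem_nhds hs] with t ht using hg1 t ht.le
    rw [this.deriv_eq, deriv_id]
  have hdc : Continuous (deriv g) := hg.continuous_deriv le_rfl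
  obtain ⟨C, hC⟩ : ∃ C, ∀ s, ‖deriv g s‖ ≤ C := by
    obtain ⟨C, hC⟩ := (isCompact_Icc (a := (0 : ℝ)) (b := 2)).exists_bound_of_continuousOn
      hdc.continuousOn
    refine ⟨max C 1, fun s => ?_⟩
    rcases lt_or_ge s 1 with hs | hs
    · rw [hd0 s hs]; simp
    · rcases le_or_gt s 2 with hs2 | hs2
      · exact (hC s ⟨by linarith, hs2⟩).trans (le_max_left _ _)
      · rw [hd1 s hs2]; simp
  -- Only `w * S` is known to be measurable, so `S` is traded for it; where `w = 0` both sides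
  -- vanish.
  have hrew : ∀ (t : ℝ) x, t⁻¹ * g (t * w x) * S x =
      (t⁻¹ * g (t * w x) * (w x)⁻¹) * (w x * S x) := fun t x => by
    by_cases hx : w x = 0
    · simp [hx, hg0 0 zero_le_one]
    · field_simp
  have htend := tendsto_integral_of_dominated_convergence (μ := μ)
    (F := fun (j : ℕ) x => ((j : ℝ) + 1)⁻¹ * g ((j + 1 : ℝ) * w x) * S x +
      c * deriv g ((j + 1 : ℝ) * w x) * N x)
    (f := fun x => (max (w x) 0) * S x + c * ({x | 0 < w x}.indicator N x))
    (fun x => ‖w x * S x‖ + |c| * C * ‖N x‖) (fun j => ?_)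
    (hS.norm.add (hN.norm.const_mul _)) (fun j => Eventually.of_forall fun x => ?_)
    (Eventually.of_forall fun x => ?_)
  · refine tendsto_nhds_unique htend ?_
    have h0 := fun j : ℕ => h ((j : ℝ) + 1) (by positivity)
    simp only [h0]
    exact tendsto_const_nhds
  · simp only [hrew]
    have h1 : AEStronglyMeasurable (fun x => (j + 1 : ℝ) * w x) μ := hw.const_mul _
    exact ((((hg.continuous.comp_aestronglyMeasurable h1).const_mul _).mul
      hw.aemeasurable.inv.aestronglyMeasurable).mul hS.1).add
      (((hdc.comp_aestronglyMeasurable h1).const_mul _).mul hN.1)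
  · have hj : (0 : ℝ) < j + 1 := by positivity
    refine (norm_add_le _ _).trans (add_le_add ?_ ?_)
    · rw [norm_mul, norm_mul (w x)]
      refine mul_le_mul_of_nonneg_right ?_ (norm_nonneg _)
      rw [norm_mul, norm_inv, Real.norm_of_nonneg hj.le, inv_mul_le_iff₀ hj]
      refine (hgb _).trans ?_
      rw [abs_mul, abs_of_pos hj, Real.norm_eq_abs]
    · rw [norm_mul, norm_mul, Real.norm_eq_abs c]
      exact mul_le_mul_of_nonneg_right
        (mul_le_mul_of_nonneg_left (hC _) (abs_nonneg c)) (norm_nonneg _)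
  · refine tendsto_const_nhds.congr' ?_
    rcases lt_or_ge 0 (w x) with hx | hx
    · obtain ⟨J, hJ⟩ := exists_nat_gt (2 / w x)
      filter_upwards [eventually_ge_atTop J] with j hj
      have hj1 : 2 < (j + 1 : ℝ) * w x := by
        rw [div_lt_iff₀ hx] at hJ
        have : (J : ℝ) ≤ j := by exact_mod_cast hj
        nlinarith
      rw [hg1 _ hj1.le, hd1 _ hj1, max_eq_left hx.le, indicator_of_mem (by exact hx),
        ← mul_assoc, inv_mul_cancel₀ (by positivity)]
      ring
    · refine Eventually.of_forall fun j => ?_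
      have hj1 : (j + 1 : ℝ) * w x ≤ 0 := mul_nonpos_of_nonneg_of_nonpos (by positivity) hx
      beta_reduce
      rw [hg0 _ (by linarith), hd0 _ (by linarith), max_eq_right hx,
        indicator_of_notMem (by simpa using hx)]
      simp

theorem integral_signed_part_eq_zero (hF : IsStronglyConvexNorm F) (hΩo : IsOpen Ω)
    (hΩb : Bornology.IsBounded Ω)
    (hu : ContDiffOn ℝ 2 u Ω) (huc : ContinuousOn u (closure Ω))
    (hu0 : ∀ x ∈ frontier Ω, u x = 0) {k : ℕ} (hk : 1 ≤ k) (hkn : k ≤ n)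
    (hN : IntegrableOn (newtonEnergy k F u) Ω)
    (hS : IntegrableOn (fun x => u x * anisoHessianOp k F u x) Ω) {σ : ℝ} (hσ : σ * σ = 1) :
    ∫ x in Ω, (max (σ * u x) 0 * anisoHessianOp k F u x +
      1 / (k : ℝ) * ({x | 0 < σ * u x}.indicator (fun x => σ * newtonEnergy k F u x) x)) = 0 := by
  obtain ⟨θ, hθ, hθ0, hθ1, hθ2, hθk⟩ := exists_profile hk
  have hk0 : k ≠ 0 := by omega
  have hS' : IntegrableOn (fun x => (σ * u x) * anisoHessianOp k F u x) Ω := by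
    simp only [mul_assoc]
    exact hS.const_mul σ
  refine integral_posPart_eq_zero (g := fun s => θ s ^ k) (hθ.pow k) (fun s hs => by rw [hθ1 s hs, zero_pow hk0]) hθ2
    (fun s => by rw [abs_of_nonneg (pow_nonneg (hθ0 s) k)]; exact hθk s)
    (((huc.mono subset_closure).aestronglyMeasurable hΩo.measurableSet).const_mul σ) hS'
    (hN.const_mul σ) fun t ht => ?_
  -- The factor `t⁻¹` in front of `θ^k` has to be absorbed into the profile before the power is
  -- taken.
  obtain ⟨c, hc0, hck⟩ : ∃ c : ℝ, 0 ≤ c ∧ c ^ k = t⁻¹ :=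
    ⟨t⁻¹ ^ ((k : ℝ)⁻¹), by positivity, Real.rpow_inv_natCast_pow (by positivity) hk0⟩
  have hprof : IsTestProfile (fun s => c * θ (t * (σ * s))) t⁻¹ := by
    refine ⟨contDiff_const.mul (hθ.comp
      (contDiff_const.mul (contDiff_const.mul contDiff_id))), fun s => mul_nonneg hc0 (hθ0 _),
      by positivity, fun s hs => ?_⟩
    have hσ1 : |σ| = 1 := by
      have : |σ| * |σ| = 1 := by rw [abs_mul_abs_self, hσ]
      nlinarith [abs_nonneg σ]
    have : t * (σ * s) ≤ 1 := by
      refine (le_abs_self _).trans ?_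
      rw [abs_mul, abs_mul, hσ1, one_mul, abs_of_pos ht]
      exact ((le_inv_mul_iff₀ ht).1 (by simpa using hs.le))
    rw [hθ1 _ this, mul_zero]
  have hder : ∀ s, deriv (fun s => (c * θ (t * (σ * s))) ^ k) s =
      σ * deriv (fun s => θ s ^ k) (t * (σ * s)) := by
    intro s
    have h1 : HasDerivAt (fun s => t * (σ * s)) (t * (σ * 1)) s :=
      ((hasDerivAt_id s).const_mul σ).const_mul t
    have h2 : HasDerivAt (fun s => θ s ^ k) (deriv (fun s => θ s ^ k) (t * (σ * s)))
      (t * (σ * s)) := ((hθ.pow k).differentiable (by norm_num) _).hasDerivAt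
    have h3 := (h2.comp s h1).const_mul t⁻¹
    have h4 : (fun s => (c * θ (t * (σ * s))) ^ k) =
        fun s => t⁻¹ * ((fun s => θ s ^ k) ∘ fun s => t * (σ * s)) s := by
      ext s; simp only [Function.comp_apply, mul_pow, hck]
    rw [h4, h3.deriv]
    field_simp
  have h := integral_profile_eq_zero hF hΩo hΩb hu huc hu0 hprof hk hkn
  simp only [hder] at h
  simp only [mul_pow, hck] at h
  rw [← h]
  exact integral_congr_ae (Eventually.of_forall fun x => by beta_reduce; ring)

theorem integral_neg_mul_anisoHessianOp (hF : IsStronglyConvexNorm F) (hΩo : IsOpen Ω)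
    (hΩb : Bornology.IsBounded Ω)
    (hu : ContDiffOn ℝ 2 u Ω) (huc : ContinuousOn u (closure Ω))
    (hu0 : ∀ x ∈ frontier Ω, u x = 0) {k : ℕ} (hk : 1 ≤ k) (hkn : k ≤ n)
    (hN : IntegrableOn (newtonEnergy k F u) Ω)
    (hS : IntegrableOn (fun x => (-u x) * anisoHessianOp k F u x) Ω)
    (hnull : ∀ᵐ x ∂(volume.restrict Ω), u x = 0 → newtonEnergy k F u x = 0) :
    ∫ x in Ω, (-u x) * anisoHessianOp k F u x =
      1 / (k : ℝ) * ∫ x in Ω, newtonEnergy k F u x := by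
  have hS' : IntegrableOn (fun x => u x * anisoHessianOp k F u x) Ω := by
    simpa using hS.neg
  have hum : AEStronglyMeasurable u (volume.restrict Ω) :=
    (huc.mono subset_closure).aestronglyMeasurable hΩo.measurableSet
  have h : ∀ {σ : ℝ}, σ * σ = 1 → Integrable (fun x => max (σ * u x) 0 * anisoHessianOp k F u x +
      1 / (k : ℝ) * ({x | 0 < σ * u x}.indicator (fun x => σ * newtonEnergy k F u x) x))
      (volume.restrict Ω) := by
    intro σ _
    have hset : NullMeasurableSet {x | 0 < σ * u x} (volume.restrict Ω) :=
      nullMeasurableSet_lt aemeasurable_const (hum.const_mul σ).aemeasurable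
    have h1 : Integrable ({x | 0 < σ * u x}.indicator
        fun x => σ * (u x * anisoHessianOp k F u x)) (volume.restrict Ω) :=
      (hS'.const_mul σ).indicator₀ hset
    refine (h1.congr (Eventually.of_forall fun x => ?_)).add
      (((hN.const_mul σ).indicator₀ hset).const_mul _)
    by_cases hx : 0 < σ * u x
    · rw [indicator_of_mem (by exact hx), max_eq_left hx.le, mul_assoc]
    · rw [indicator_of_notMem (by exact hx), max_eq_right (not_lt.1 hx), zero_mul]
  have h1 := integral_signed_part_eq_zero hF hΩo hΩb hu huc hu0 hk hkn hN hS' (σ := 1) (by norm_num)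
  have h2 := integral_signed_part_eq_zero hF hΩo hΩb hu huc hu0 hk hkn hN hS' (σ := -1)
    (by norm_num)
  -- The difference of the positive parts of `u` and `-u` is `u`, while the factor `σ` turns the
  -- energy terms into their sum over `{u ≠ 0}`; `hnull` covers `{u = 0}`.
  have h3 := integral_sub (h (σ := 1) (by norm_num)) (h (σ := -1) (by norm_num))
  rw [h1, h2, sub_zero] at h3
  rw [← sub_eq_zero, ← integral_const_mul, ← integral_sub hS (hN.const_mul _), ← neg_eq_zero,
    ← integral_neg, ← h3]
  refine integral_congr_ae ?_
  filter_upwards [hnull] with x hx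
  rcases lt_trichotomy (u x) 0 with hux | hux | hux
  · simp [indicator, hux, hux.le, not_lt.2 hux.le]
  · simp [indicator, hux, hx hux]
  · simp [indicator, hux, hux.le, not_lt.2 hux.le]
    ring

end Limits

/-! ### Hausdorff measure of hyperplane slices and local straightening of `u` -/

section Coarea

open Filter Topology Set Metric
open scoped NNReal ENNReal

variable {n : ℕ}

theorem euclideanHausdorffMeasure_image_le {X Y : Type*} [EMetricSpace X] [MeasurableSpace X]
    [BorelSpace X] [EMetricSpace Y] [MeasurableSpace Y] [BorelSpace Y] {f : X → Y} {c : ℝ≥0}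
    {s : Set X} (hf : LipschitzOnWith c f s) (d : ℕ) :
    Measure.euclideanHausdorffMeasure d (f '' s) ≤
      (c : ℝ≥0∞) ^ d * Measure.euclideanHausdorffMeasure d s := by
  simp only [Measure.euclideanHausdorffMeasure_def, Measure.smul_apply, ENNReal.smul_def,
    smul_eq_mul]
  rw [mul_left_comm]
  refine mul_le_mul_right ?_ _
  simpa using hf.hausdorffMeasure_image_le (d := d) (by positivity)

theorem le_euclideanHausdorffMeasure_image {X Y : Type*} [EMetricSpace X] [MeasurableSpace X]
    [BorelSpace X] [EMetricSpace Y] [MeasurableSpace Y] [BorelSpace Y] {f : X → Y} {c : ℝ≥0}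
    {s : Set X} (hf : ∀ x ∈ s, ∀ y ∈ s, edist x y ≤ c * edist (f x) (f y)) (d : ℕ) :
    Measure.euclideanHausdorffMeasure d s ≤
      (c : ℝ≥0∞) ^ d * Measure.euclideanHausdorffMeasure d (f '' s) := by
  rcases s.eq_empty_or_nonempty with rfl | ⟨x0, -⟩
  · simp
  have : Nonempty X := ⟨x0⟩
  have hinj : InjOn f s := fun x hx y hy hxy => by
    have := hf x hx y hy
    rw [hxy, edist_self, mul_zero] at this
    exact edist_le_zero.1 this
  have hleft := hinj.leftInvOn_invFunOn
  have hg : LipschitzOnWith c (Function.invFunOn f s) (f '' s) := by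
    rintro _ ⟨x, hx, rfl⟩ _ ⟨y, hy, rfl⟩
    rw [hleft hx, hleft hy]
    exact hf x hx y hy
  have h := euclideanHausdorffMeasure_image_le hg d
  rwa [hleft.image_image] at h

theorem volume_eq_euclideanHausdorffMeasure :
    (volume : Measure (Eucl n)) = Measure.euclideanHausdorffMeasure n :=
  (EuclideanSpace.euclideanHausdorffMeasure_eq_volume n).symm

/-- Each slice is an isometric copy of a section of a measurable subset of `ℝ × eᗮ`, and measures of
sections depend measurably on the base point. -/
theorem measurable_euclideanHausdorffMeasure_slice {e : Eucl n} (he : ‖e‖ = 1) {T : Set (Eucl n)}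
    (hT : MeasurableSet T) : Measurable fun s : ℝ =>
      Measure.euclideanHausdorffMeasure (n - 1) (T ∩ {y | inner ℝ e y = s}) := by
  set K := (Submodule.span ℝ {e})ᗮ with hK
  have he0 : e ≠ 0 := by rintro rfl; simp at he
  have hfr : Module.finrank ℝ K = n - 1 := by
    have := finrank_span_singleton_orthogonal he0
    exact Nat.eq_sub_of_add_eq this
  have hS : MeasurableSet {p : ℝ × K | p.1 • e + (p.2 : Eucl n) ∈ T} :=
    hT.preimage (by fun_prop)
  have hm := measurable_measure_prodMk_left (ν := (volume : Measure K)) hS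
  convert hm using 2 with s
  have hiso : Isometry fun z : K => s • e + (z : Eucl n) :=
    (isometry_add_left (s • e)).comp K.subtypeₗᵢ.isometry
  rw [← InnerProductSpace.euclideanHausdorffMeasure_eq_volume (V := K), hfr,
    ← hiso.euclideanHausdorffMeasure_image]
  congr 1
  ext y
  simp only [mem_inter_iff, mem_ofPred_eq, mem_image, mem_preimage]
  constructor
  · rintro ⟨hy, hs⟩
    have hmem : y - s • e ∈ K := by
      rw [hK, Submodule.mem_orthogonal_singleton_iff_inner_right, inner_sub_right,
        real_inner_smul_right, real_inner_self_eq_norm_sq, he, hs]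
      ring
    exact ⟨⟨_, hmem⟩, by simpa using hy, by simp⟩
  · rintro ⟨z, hz, rfl⟩
    refine ⟨hz, ?_⟩
    have := (Submodule.mem_orthogonal_singleton_iff_inner_right).1 z.2
    rw [inner_add_right, real_inner_smul_right, real_inner_self_eq_norm_sq, he, this]
    ring

theorem lintegral_euclideanHausdorffMeasure_slice {e : Eucl n} (he : ‖e‖ = 1) {T : Set (Eucl n)}
    (hT : MeasurableSet T) : ∫⁻ s : ℝ,
      Measure.euclideanHausdorffMeasure (n - 1) (T ∩ {y | inner ℝ e y = s}) = volume T := by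
  have he0 : e ≠ 0 := by rintro rfl; simp at he
  have h := EuclideanGeometry.euclideanHausdorffMeasure_eq_lintegral (0 : Eucl n) he0 hT
  rw [finrank_euclideanSpace_fin, ← volume_eq_euclideanHausdorffMeasure, ← ofReal_norm, he,
    ENNReal.ofReal_one, one_mul] at h
  rw [h]
  refine lintegral_congr fun s => ?_
  congr 2
  ext y
  simp only [vadd_eq_add, add_zero, SetLike.mem_coe, AffineSubspace.mem_mk', mem_ofPred_eq,
    vsub_eq_sub]
  rw [Submodule.mem_orthogonal_singleton_iff_inner_right, inner_sub_right, real_inner_smul_right,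
    real_inner_self_eq_norm_sq, he, sub_eq_zero]
  simp

/-- On `U`, the function `u` is `c`-close to a linear function after a bilipschitz change of
coordinates. -/
def IsNearlyLinearOn (u : Eucl n → ℝ) (c : ℝ≥0) (U : Set (Eucl n)) : Prop :=
  ∃ (Φ : Eucl n → Eucl n) (e : Eucl n) (a : ℝ), ‖e‖ = 1 ∧ 0 < a ∧
    (∀ x ∈ U, ∀ y ∈ U, edist x y ≤ c * edist (Φ x) (Φ y)) ∧ LipschitzOnWith c Φ U ∧
    (∀ x ∈ U, u x = a * inner ℝ e (Φ x)) ∧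
    ∀ x ∈ U, a ≤ c * ‖gradient u x‖ ∧ ‖gradient u x‖ ≤ c * a

/-- The map `Φ` replaces the coordinate along `e = ∇u(x₀)/a` by `u/a`. By strict differentiability
`Φ - id` has small Lipschitz constant near `x₀`. -/
theorem exists_isNearlyLinearOn {u : Eucl n → ℝ} {x₀ : Eucl n} (hu : ContDiffAt ℝ 1 u x₀)
    (hx₀ : gradient u x₀ ≠ 0) {c : ℝ≥0} (hc : 1 < c) : ∃ U ∈ 𝓝 x₀, IsNearlyLinearOn u c U := by
  set a := ‖gradient u x₀‖ with ha
  have hapos : 0 < a := norm_pos_iff.2 hx₀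
  set e := a⁻¹ • gradient u x₀ with he
  have hc1 : (1 : ℝ) < c := by exact_mod_cast hc
  have hen : ‖e‖ = 1 := by
    rw [he, norm_smul, Real.norm_of_nonneg (by positivity), ← ha, inv_mul_cancel₀ hapos.ne']
  have hae : gradient u x₀ = a • e := by
    rw [he, smul_smul, mul_inv_cancel₀ hapos.ne', one_smul]
  clear_value e
  -- With this Lipschitz constant for `Φ - id`, the lower bound is `1 - η = c⁻¹`, and the upper one
  -- is `1 + η ≤ c` because `c + c⁻¹ ≥ 2`.
  set η : ℝ := 1 - (c : ℝ)⁻¹ with hη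
  have hηpos : 0 < η := by
    have := inv_lt_one_of_one_lt₀ hc1
    rw [hη]; linarith
  have hη2 : 1 + η ≤ c := by
    have : (c : ℝ) * (c : ℝ)⁻¹ = 1 := mul_inv_cancel₀ (by positivity)
    have h2 : 0 < (c : ℝ)⁻¹ := by positivity
    rw [hη]
    nlinarith [sq_nonneg ((c : ℝ) - 1), mul_pos h2 h2]
  have hstrict : HasStrictFDerivAt u (fderiv ℝ u x₀) x₀ := hu.hasStrictFDerivAt (by norm_num)
  obtain ⟨U1, hU1, happ⟩ := hstrict.approximates_deriv_on_nhds
    (c := (η * a).toNNReal) (Or.inr (Real.toNNReal_pos.2 (mul_pos hηpos hapos)))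
  have hgc : ContinuousAt (fun x => ‖gradient u x‖) x₀ :=
    (hu.gradient (m := 0) (by norm_num)).continuousAt.norm
  have hev1 : ∀ᶠ x in 𝓝 x₀, ‖gradient u x‖ < c * a :=
    hgc.eventually (gt_mem_nhds (show a < c * a by nlinarith))
  have hev2 : ∀ᶠ x in 𝓝 x₀, a < c * ‖gradient u x‖ :=
    (hgc.const_mul (c : ℝ)).eventually (lt_mem_nhds (show a < c * a by nlinarith))
  refine ⟨U1 ∩ ({x | ‖gradient u x‖ < c * a} ∩ {x | a < c * ‖gradient u x‖}),
    inter_mem hU1 (inter_mem hev1 hev2), fun x => x + (u x / a - inner ℝ e x) • e, e, a, hen,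
    hapos, ?_⟩
  have hkey : ∀ x ∈ U1, ∀ y ∈ U1, ‖(x + (u x / a - inner ℝ e x) • e) -
      (y + (u y / a - inner ℝ e y) • e) - (x - y)‖ ≤ η * ‖x - y‖ := by
    intro x hx y hy
    have h1 : (x + (u x / a - inner ℝ e x) • e) - (y + (u y / a - inner ℝ e y) • e) - (x - y) =
        (a⁻¹ * (u x - u y - fderiv ℝ u x₀ (x - y))) • e := by
      have : fderiv ℝ u x₀ (x - y) = a * inner ℝ e x - a * inner ℝ e y := by
        rw [← inner_gradient_left, hae, real_inner_smul_left, inner_sub_right]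
        ring
      rw [this]
      have h2 : a⁻¹ * (u x - u y - (a * inner ℝ e x - a * inner ℝ e y)) =
        (u x / a - inner ℝ e x) - (u y / a - inner ℝ e y) := by field_simp; ring
      rw [h2]
      module
    rw [h1, norm_smul, hen, mul_one, norm_mul, norm_inv, Real.norm_of_nonneg hapos.le,
      inv_mul_le_iff₀ hapos]
    refine (happ x hx y hy).trans (le_of_eq ?_)
    rw [Real.coe_toNNReal _ (mul_pos hηpos hapos).le]
    ring
  refine ⟨fun x hx y hy => ?_, LipschitzOnWith.of_dist_le_mul fun x hx y hy => ?_, fun x hx => ?_,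
    fun x hx => ⟨hx.2.2.le, hx.2.1.le⟩⟩
  · have h := hkey x hx.1 y hy.1
    rw [edist_dist, edist_dist, ← ENNReal.ofReal_coe_nnreal, ← ENNReal.ofReal_mul c.coe_nonneg]
    refine ENNReal.ofReal_le_ofReal ?_
    rw [dist_eq_norm, dist_eq_norm]
    set p := (x + (u x / a - inner ℝ e x) • e) - (y + (u y / a - inner ℝ e y) • e)
    have h2 : ‖x - y‖ - ‖p‖ ≤ η * ‖x - y‖ := by
      refine le_trans ?_ h
      rw [norm_sub_rev p]
      exact norm_sub_norm_le _ _
    have h3 : (c : ℝ)⁻¹ * ‖x - y‖ ≤ ‖p‖ := by rw [hη] at h2; linarith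
    exact (inv_mul_le_iff₀ (by positivity)).1 h3
  · have h := hkey x hx.1 y hy.1
    rw [dist_eq_norm, dist_eq_norm]
    set p := (x + (u x / a - inner ℝ e x) • e) - (y + (u y / a - inner ℝ e y) • e)
    have h2 : ‖p‖ - ‖x - y‖ ≤ η * ‖x - y‖ := (norm_sub_norm_le _ _).trans h
    calc ‖p‖ ≤ (1 + η) * ‖x - y‖ := by linarith
      _ ≤ c * ‖x - y‖ := mul_le_mul_of_nonneg_right hη2 (norm_nonneg _)
  · rw [inner_add_right, real_inner_smul_right, real_inner_self_eq_norm_sq, hen]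
    field_simp
    ring

end Coarea

/-! ### The coarea formula for sets of noncritical points -/

section Coarea

open Filter Topology Set Metric
open scoped NNReal ENNReal

variable {n : ℕ} {u : Eucl n → ℝ}

/-- The area of the slice of `S` by the level set of `u` at height `t`. -/
def sliceArea (u : Eucl n → ℝ) (S : Set (Eucl n)) (t : ℝ) : ℝ≥0∞ :=
  Measure.euclideanHausdorffMeasure (n - 1) (S ∩ u ⁻¹' {t})

/-- The coarea formula for `S` up to the factor `C`. -/
def IsCoareaUpTo (u : Eucl n → ℝ) (C : ℝ≥0∞) (S : Set (Eucl n)) : Prop :=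
  ∃ G : ℝ → ℝ≥0∞, Measurable G ∧ (∀ t, G t ≤ C * sliceArea u S t) ∧
    (∀ t, sliceArea u S t ≤ C * G t) ∧ (∫⁻ t, G t) ≤ C * ∫⁻ x in S, ‖gradient u x‖ₑ ∧
    ∫⁻ x in S, ‖gradient u x‖ₑ ≤ C * ∫⁻ t, G t

/-- The comparison function is the area of the hyperplane slices of `Φ(S)`, whose measurability and
integral come from Fubini. Slices distort by at most `c^(n-1)`, volume by `c^n` and the gradient by
`c`; all fit under `c^(n+1)`. -/
theorem IsNearlyLinearOn.isCoareaUpTo {c : ℝ≥0} (hc : 1 ≤ c) {U S : Set (Eucl n)}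
    (hU : IsNearlyLinearOn u c U) (hSU : S ⊆ U) (hS : MeasurableSet S) :
    IsCoareaUpTo u ((c : ℝ≥0∞) ^ (n + 1)) S := by
  obtain ⟨Φ, e, a, he, ha, hanti, hlip, hu, hgrad⟩ := hU
  have hc' : (1 : ℝ≥0∞) ≤ c := by exact_mod_cast hc
  have hanti' : ∀ x ∈ S, ∀ y ∈ S, edist x y ≤ c * edist (Φ x) (Φ y) := fun x hx y hy =>
    hanti x (hSU hx) y (hSU hy)
  have hlip' : LipschitzOnWith c Φ S := hlip.mono hSU
  have hinj : InjOn Φ S := fun x hx y hy hxy => by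
    have := hanti' x hx y hy
    rw [hxy, edist_self, mul_zero] at this
    exact edist_le_zero.1 this
  set T := Φ '' S with hT
  have hTm : MeasurableSet T := hS.image_of_continuousOn_injOn hlip'.continuousOn hinj
  have hslice : ∀ t, Φ '' (S ∩ u ⁻¹' {t}) = T ∩ {y | inner ℝ e y = t / a} := by
    intro t
    ext y
    constructor
    · rintro ⟨x, ⟨hx, hxt⟩, rfl⟩
      refine ⟨⟨x, hx, rfl⟩, ?_⟩
      have h := hu x (hSU hx)
      rw [mem_preimage, mem_singleton_iff] at hxt
      rw [hxt] at h
      rw [mem_ofPred_eq, h, mul_div_cancel_left₀ _ ha.ne']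
    · rintro ⟨⟨x, hx, rfl⟩, hy⟩
      refine ⟨x, ⟨hx, ?_⟩, rfl⟩
      rw [mem_ofPred_eq, eq_div_iff ha.ne'] at hy
      rw [mem_preimage, mem_singleton_iff, hu x (hSU hx), mul_comm, hy]
  have hpow : (c : ℝ≥0∞) ^ (n - 1) ≤ (c : ℝ≥0∞) ^ (n + 1) := pow_le_pow_right₀ hc' (by omega)
  have hGint : ∫⁻ t : ℝ, Measure.euclideanHausdorffMeasure (n - 1)
      (T ∩ {y | inner ℝ e y = t / a}) = ENNReal.ofReal a * volume T := by
    have hm := measurable_euclideanHausdorffMeasure_slice he hTm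
    have h := lintegral_map (μ := volume) hm (measurable_mul_const a⁻¹)
    rw [Real.map_volume_mul_right (inv_ne_zero ha.ne'), inv_inv, abs_of_pos ha,
      lintegral_smul_measure, lintegral_euclideanHausdorffMeasure_slice he hTm] at h
    simpa [div_eq_mul_inv] using h.symm
  have hvT : volume T ≤ (c : ℝ≥0∞) ^ n * volume S := by
    rw [volume_eq_euclideanHausdorffMeasure]
    exact euclideanHausdorffMeasure_image_le hlip' n
  have hvS : volume S ≤ (c : ℝ≥0∞) ^ n * volume T := by
    rw [volume_eq_euclideanHausdorffMeasure]
    exact le_euclideanHausdorffMeasure_image hanti' n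
  have hg1 : ENNReal.ofReal a * volume S ≤ c * ∫⁻ x in S, ‖gradient u x‖ₑ := by
    rw [← setLIntegral_const, ← lintegral_const_mul' _ _ ENNReal.coe_ne_top]
    refine setLIntegral_mono_ae' hS (Eventually.of_forall fun x hx => ?_)
    rw [← ofReal_norm, ← ENNReal.ofReal_coe_nnreal, ← ENNReal.ofReal_mul c.coe_nonneg]
    exact ENNReal.ofReal_le_ofReal (hgrad x (hSU hx)).1
  have hg2 : ∫⁻ x in S, ‖gradient u x‖ₑ ≤ c * (ENNReal.ofReal a * volume S) := by
    rw [← setLIntegral_const, ← lintegral_const_mul' _ _ ENNReal.coe_ne_top]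
    refine setLIntegral_mono_ae' hS (Eventually.of_forall fun x hx => ?_)
    rw [← ofReal_norm, ← ENNReal.ofReal_coe_nnreal, ← ENNReal.ofReal_mul c.coe_nonneg]
    exact ENNReal.ofReal_le_ofReal (hgrad x (hSU hx)).2
  refine ⟨fun t => Measure.euclideanHausdorffMeasure (n - 1) (T ∩ {y | inner ℝ e y = t / a}),
    (measurable_euclideanHausdorffMeasure_slice he hTm).comp (measurable_id.div_const a),
    fun t => ?_, fun t => ?_, ?_, ?_⟩
  · beta_reduce
    rw [← hslice]
    exact (euclideanHausdorffMeasure_image_le (hlip'.mono inter_subset_left) _).trans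
      (mul_le_mul_left hpow _)
  · beta_reduce
    rw [← hslice]
    exact (le_euclideanHausdorffMeasure_image (fun x hx y hy => hanti' x hx.1 y hy.1) _).trans
      (mul_le_mul_left hpow _)
  · rw [hGint]
    calc ENNReal.ofReal a * volume T ≤ ENNReal.ofReal a * ((c : ℝ≥0∞) ^ n * volume S) :=
          mul_le_mul_right hvT _
      _ = (c : ℝ≥0∞) ^ n * (ENNReal.ofReal a * volume S) := by ring
      _ ≤ (c : ℝ≥0∞) ^ n * (c * ∫⁻ x in S, ‖gradient u x‖ₑ) := mul_le_mul_right hg1 _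
      _ = _ := by ring
  · rw [hGint]
    calc ∫⁻ x in S, ‖gradient u x‖ₑ ≤ c * (ENNReal.ofReal a * volume S) := hg2
      _ ≤ c * (ENNReal.ofReal a * ((c : ℝ≥0∞) ^ n * volume T)) :=
          mul_le_mul_right (mul_le_mul_right hvS _) _
      _ = _ := by ring

theorem isCoareaUpTo_iUnion {C : ℝ≥0∞} {S : ℕ → Set (Eucl n)} (hS : ∀ i, MeasurableSet (S i))
    (hSt : ∀ i t, MeasurableSet (S i ∩ u ⁻¹' {t})) (hd : Pairwise (Function.onFun Disjoint S))
    (h : ∀ i, IsCoareaUpTo u C (S i)) : IsCoareaUpTo u C (⋃ i, S i) := by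
  choose G hGm h1 h2 h3 h4 using h
  have hs : ∀ t, sliceArea u (⋃ i, S i) t = ∑' i, sliceArea u (S i) t := by
    intro t
    rw [sliceArea, iUnion_inter, measure_iUnion (fun i j hij =>
      (hd hij).mono inter_subset_left inter_subset_left) (fun i => hSt i t)]
    rfl
  have hint : ∫⁻ x in ⋃ i, S i, ‖gradient u x‖ₑ = ∑' i, ∫⁻ x in S i, ‖gradient u x‖ₑ :=
    lintegral_iUnion hS hd _
  have hG : ∫⁻ t, ∑' i, G i t = ∑' i, ∫⁻ t, G i t :=
    lintegral_tsum fun i => (hGm i).aemeasurable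
  refine ⟨fun t => ∑' i, G i t, Measurable.tsum hGm, fun t => ?_, fun t => ?_, ?_, ?_⟩
  · rw [hs, ← ENNReal.tsum_mul_left]
    exact ENNReal.tsum_le_tsum fun i => h1 i t
  · rw [hs, ← ENNReal.tsum_mul_left]
    exact ENNReal.tsum_le_tsum fun i => h2 i t
  · rw [hint, hG, ← ENNReal.tsum_mul_left]
    exact ENNReal.tsum_le_tsum fun i => h3 i
  · rw [hint, hG, ← ENNReal.tsum_mul_left]
    exact ENNReal.tsum_le_tsum fun i => h4 i

theorem measurableSet_inter_preimage_singleton {R : Set (Eucl n)} (hR : IsOpen R)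
    (hu : ContinuousOn u R) (t : ℝ) : MeasurableSet (R ∩ u ⁻¹' {t}) := by
  have : R ∩ u ⁻¹' {t} = R \ (R ∩ u ⁻¹' {t}ᶜ) := by
    ext x; simp
  rw [this]
  exact hR.measurableSet.diff (hu.isOpen_inter_preimage hR isOpen_compl_singleton).measurableSet

/-- A countable subcover by straightening neighbourhoods is made disjoint; the constant does not
depend on the piece, so summation preserves it. -/
theorem isCoareaUpTo_of_subset {R : Set (Eucl n)} (hR : IsOpen R)
    (hu : ∀ x ∈ R, ContDiffAt ℝ 1 u x) (hg : ∀ x ∈ R, gradient u x ≠ 0) {S : Set (Eucl n)}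
    (hSR : S ⊆ R) (hS : MeasurableSet S) {c : ℝ≥0} (hc : 1 < c) :
    IsCoareaUpTo u ((c : ℝ≥0∞) ^ (n + 1)) S := by
  have hcont : ContinuousOn u R := fun x hx => (hu x hx).continuousAt.continuousWithinAt
  choose! U hU hlin using fun x (hx : x ∈ R) => exists_isNearlyLinearOn (hu x hx) (hg x hx) hc
  obtain ⟨A, hAR, hAc, hcover⟩ := TopologicalSpace.countable_cover_nhdsWithin
    (f := fun x => interior (U x)) (s := R)
    fun x hx => mem_nhdsWithin_of_mem_nhds (interior_mem_nhds.2 (hU x hx))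
  rcases A.eq_empty_or_nonempty with rfl | hne
  · have hSe : S = ∅ := by
      refine subset_empty_iff.1 (hSR.trans ?_)
      simpa using hcover
    subst hSe
    exact ⟨fun _ => 0, measurable_const, fun t => zero_le, fun t => by simp [sliceArea],
      by simp, by simp⟩
  obtain ⟨p, rfl⟩ := hAc.exists_eq_range hne
  let W : ℕ → Set (Eucl n) := fun i => interior (U (p i))
  let D : ℕ → Set (Eucl n) := fun i => S ∩ disjointed W i
  have hDm : ∀ i, MeasurableSet (D i) := fun i =>
    hS.inter (MeasurableSet.disjointed (fun i => isOpen_interior.measurableSet) i)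
  have hSD : S = ⋃ i, D i := by
    rw [← inter_iUnion, iUnion_disjointed]
    refine (inter_eq_left.2 (hSR.trans (hcover.trans ?_))).symm
    intro x hx
    simpa [W] using hx
  rw [hSD]
  refine isCoareaUpTo_iUnion hDm (fun i t => ?_) (fun i j hij =>
    ((disjoint_disjointed W) hij).mono inter_subset_right inter_subset_right) fun i => ?_
  · have : D i ∩ u ⁻¹' {t} = D i ∩ (R ∩ u ⁻¹' {t}) := by
      rw [← inter_assoc, inter_eq_left.2 (inter_subset_left.trans hSR)]
    rw [this]
    exact (hDm i).inter (measurableSet_inter_preimage_singleton hR hcont t)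
  · exact (hlin (p i) (hAR (mem_range_self i))).isCoareaUpTo hc.le
      (inter_subset_right.trans ((disjointed_subset W i).trans interior_subset)) (hDm i)

/-- The **coarea formula** for sets. -/
theorem measurable_sliceArea_and_lintegral {R : Set (Eucl n)} (hR : IsOpen R)
    (hu : ∀ x ∈ R, ContDiffAt ℝ 1 u x) (hg : ∀ x ∈ R, gradient u x ≠ 0) {S : Set (Eucl n)}
    (hSR : S ⊆ R) (hS : MeasurableSet S) :
    Measurable (sliceArea u S) ∧ ∫⁻ t, sliceArea u S t = ∫⁻ x in S, ‖gradient u x‖ₑ := by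
  let c : ℕ → ℝ≥0 := fun j => 1 + 1 / ((j : ℝ≥0) + 1)
  have hc1 : ∀ j, 1 < c j := fun j => by
    simp only [c]
    exact lt_add_of_pos_right _ (by positivity)
  have hclim : Tendsto (fun j => ((c j : ℝ≥0) : ℝ≥0∞) ^ (n + 1)) atTop (𝓝 1) := by
    have h1 : Tendsto c atTop (𝓝 1) := by
      have := (tendsto_one_div_add_atTop_nhds_zero_nat (𝕜 := ℝ≥0)).const_add 1
      simpa [c] using this
    have h2 : Tendsto (fun j => c j ^ (n + 1)) atTop (𝓝 1) := by
      simpa using h1.pow (n + 1)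
    have h3 := ENNReal.tendsto_coe.2 h2
    simpa using h3
  choose G hGm h1 h2 h3 h4 using fun j => isCoareaUpTo_of_subset hR hu hg hSR hS (hc1 j)
  have hcpos : ∀ j, ((c j : ℝ≥0) : ℝ≥0∞) ^ (n + 1) ≠ 0 := fun j =>
    pow_ne_zero _ (by simpa using (zero_lt_one.trans (hc1 j)).ne')
  have hctop : ∀ j, ((c j : ℝ≥0) : ℝ≥0∞) ^ (n + 1) ≠ ⊤ := fun j =>
    ENNReal.pow_ne_top ENNReal.coe_ne_top
  -- The two-sided comparison with constants tending to 1 squeezes `G j t`; measurability of the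
  -- slice area is obtained only through this limit.
  have hlim : ∀ t, Tendsto (fun j => G j t) atTop (𝓝 (sliceArea u S t)) := by
    intro t
    have hup : Tendsto (fun j => ((c j : ℝ≥0) : ℝ≥0∞) ^ (n + 1) * sliceArea u S t) atTop
        (𝓝 (sliceArea u S t)) := by
      simpa using ENNReal.Tendsto.mul_const hclim (b := sliceArea u S t) (Or.inl one_ne_zero)
    have hlo : Tendsto (fun j => (((c j : ℝ≥0) : ℝ≥0∞) ^ (n + 1))⁻¹ * sliceArea u S t) atTop
        (𝓝 (sliceArea u S t)) := by
      simpa using ENNReal.Tendsto.mul_const (tendsto_inv_iff.2 hclim)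
        (b := sliceArea u S t) (Or.inl (by simp))
    refine tendsto_of_tendsto_of_tendsto_of_le_of_le hlo hup (fun j => ?_) (fun j => h1 j t)
    rw [mul_comm, ← div_eq_mul_inv]
    exact ENNReal.div_le_of_le_mul' (h2 j t)
  have hm : Measurable (sliceArea u S) :=
    ENNReal.measurable_of_tendsto hGm (tendsto_pi_nhds.2 hlim)
  refine ⟨hm, le_antisymm ?_ ?_⟩
  · have hb : ∀ j, ∫⁻ t, sliceArea u S t ≤ ((c j : ℝ≥0) : ℝ≥0∞) ^ (n + 1) *
        (((c j : ℝ≥0) : ℝ≥0∞) ^ (n + 1) * ∫⁻ x in S, ‖gradient u x‖ₑ) := fun j =>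
      calc ∫⁻ t, sliceArea u S t ≤ ∫⁻ t, ((c j : ℝ≥0) : ℝ≥0∞) ^ (n + 1) * G j t :=
            lintegral_mono (h2 j)
        _ = ((c j : ℝ≥0) : ℝ≥0∞) ^ (n + 1) * ∫⁻ t, G j t := lintegral_const_mul _ (hGm j)
        _ ≤ _ := mul_le_mul_right (h3 j) _
    have hl := ENNReal.Tendsto.mul_const (ENNReal.Tendsto.mul hclim (Or.inl one_ne_zero) hclim
      (Or.inl one_ne_zero)) (b := ∫⁻ x in S, ‖gradient u x‖ₑ) (Or.inl (by simp))
    simp only [one_mul, mul_assoc] at hl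
    exact ge_of_tendsto' hl hb
  · have hb : ∀ j, ∫⁻ x in S, ‖gradient u x‖ₑ ≤ ((c j : ℝ≥0) : ℝ≥0∞) ^ (n + 1) *
        (((c j : ℝ≥0) : ℝ≥0∞) ^ (n + 1) * ∫⁻ t, sliceArea u S t) := fun j =>
      calc ∫⁻ x in S, ‖gradient u x‖ₑ ≤ ((c j : ℝ≥0) : ℝ≥0∞) ^ (n + 1) * ∫⁻ t, G j t := h4 j
        _ ≤ ((c j : ℝ≥0) : ℝ≥0∞) ^ (n + 1) *
            ∫⁻ t, ((c j : ℝ≥0) : ℝ≥0∞) ^ (n + 1) * sliceArea u S t :=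
          mul_le_mul_right (lintegral_mono (h1 j)) _
        _ = _ := by rw [lintegral_const_mul _ hm]
    have hl := ENNReal.Tendsto.mul_const (ENNReal.Tendsto.mul hclim (Or.inl one_ne_zero) hclim
      (Or.inl one_ne_zero)) (b := ∫⁻ t, sliceArea u S t) (Or.inl (by simp))
    simp only [one_mul, mul_assoc] at hl
    exact ge_of_tendsto' hl hb

end Coarea

/-! ### The coarea formula for integrable functions -/

section Disintegration

open Filter Topology Set ProbabilityTheory
open scoped NNReal ENNReal

variable {n : ℕ} {u : Eucl n → ℝ} {R : Set (Eucl n)}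

/-- The kernel of surface measures on the level sets of `u` inside `R`. -/
def surfaceKernel (hR : IsOpen R) (hu : ∀ x ∈ R, ContDiffAt ℝ 1 u x)
    (hg : ∀ x ∈ R, gradient u x ≠ 0) : Kernel ℝ (Eucl n) where
  toFun t := (Measure.euclideanHausdorffMeasure (n - 1)).restrict (R ∩ u ⁻¹' {t})
  measurable' := by
    refine Measure.measurable_of_measurable_coe _ fun S hS => ?_
    have h := (measurable_sliceArea_and_lintegral hR hu hg (S := S ∩ R) inter_subset_right
      (hS.inter hR.measurableSet)).1
    convert h using 1
    ext t
    rw [Measure.restrict_apply hS, sliceArea, inter_assoc]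

theorem surfaceKernel_apply (hR : IsOpen R) (hu : ∀ x ∈ R, ContDiffAt ℝ 1 u x)
    (hg : ∀ x ∈ R, gradient u x ≠ 0) (t : ℝ) : surfaceKernel hR hu hg t =
      (Measure.euclideanHausdorffMeasure (n - 1)).restrict (R ∩ u ⁻¹' {t}) := rfl

theorem measurable_gradient : Measurable (gradient u) :=
  (InnerProductSpace.toDual ℝ (Eucl n)).symm.continuous.measurable.comp (measurable_fderiv ℝ u)

/-- The coarea formula as an equality of measures: the surface measures mixed over `t` give `|∇u|
dx` on `R`. Integrability on almost every level then follows from the general theory of kernels. -/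
theorem surfaceKernel_comp_volume (hR : IsOpen R) (hu : ∀ x ∈ R, ContDiffAt ℝ 1 u x)
    (hg : ∀ x ∈ R, gradient u x ≠ 0) :
    (surfaceKernel hR hu hg ∘ₖ Kernel.const Unit (volume : Measure ℝ)) () =
      (volume.restrict R).withDensity fun x => (‖gradient u x‖₊ : ℝ≥0∞) := by
  ext S hS
  have h := (measurable_sliceArea_and_lintegral hR hu hg (S := S ∩ R) inter_subset_right
      (hS.inter hR.measurableSet)).2
  rw [Kernel.comp_apply' _ _ _ hS, Kernel.const_apply, withDensity_apply _ hS,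
    Measure.restrict_restrict hS]
  refine Eq.trans (lintegral_congr fun t => ?_) h
  rw [surfaceKernel_apply, Measure.restrict_apply hS, sliceArea, inter_assoc]

/-- The **coarea formula** for integrable functions. -/
theorem integral_norm_gradient_smul_eq (hR : IsOpen R) (hu : ∀ x ∈ R, ContDiffAt ℝ 1 u x)
    (hg : ∀ x ∈ R, gradient u x ≠ 0) {f : Eucl n → ℝ}
    (hf : IntegrableOn (fun x => ‖gradient u x‖ * f x) R) :
    (∀ᵐ t : ℝ, IntegrableOn f (R ∩ u ⁻¹' {t}) (Measure.euclideanHausdorffMeasure (n - 1))) ∧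
    Integrable (fun t : ℝ =>
      ∫ x in R ∩ u ⁻¹' {t}, f x ∂(Measure.euclideanHausdorffMeasure (n - 1))) ∧
    ∫ x in R, ‖gradient u x‖ * f x = ∫ t : ℝ, ∫ x in R ∩ u ⁻¹' {t}, f x
      ∂(Measure.euclideanHausdorffMeasure (n - 1)) := by
  have hm : Measurable fun x => ‖gradient u x‖₊ := measurable_gradient.nnnorm
  have hint : Integrable f
      ((surfaceKernel hR hu hg ∘ₖ Kernel.const Unit (volume : Measure ℝ)) ()) := by
    rw [surfaceKernel_comp_volume, integrable_withDensity_iff_integrable_smul hm]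
    exact hf
  refine ⟨hint.ae_of_comp, hint.integral_comp, ?_⟩
  have h := Kernel.integral_comp hint
  rw [surfaceKernel_comp_volume, integral_withDensity_eq_integral_smul hm] at h
  exact h

/-- The set `R ∩ {u = c}` meets only the level `t = c`, so by the coarea formula `|∇u|` integrates
to zero over it; as `∇u ≠ 0` there, the set is null. -/
theorem ae_gradient_eq_zero_of_eq_const (hR : IsOpen R) (hu : ∀ x ∈ R, ContDiffAt ℝ 1 u x)
    (hg : ∀ x ∈ R, gradient u x ≠ 0) (c : ℝ) : ∀ᵐ x, x ∈ R → u x ≠ c := by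
  have hcont : ContinuousOn u R := fun x hx => (hu x hx).continuousAt.continuousWithinAt
  have hZ := measurableSet_inter_preimage_singleton hR hcont c
  have h := (measurable_sliceArea_and_lintegral hR hu hg inter_subset_left hZ).2
  have h0 : ∫⁻ t, sliceArea u (R ∩ u ⁻¹' {c}) t = 0 := by
    rw [lintegral_eq_zero_iff (measurable_sliceArea_and_lintegral hR hu hg inter_subset_left hZ).1]
    have : ∀ᵐ t : ℝ, t ≠ c := by simp [ae_iff]
    filter_upwards [this] with t ht
    have : R ∩ u ⁻¹' {c} ∩ u ⁻¹' {t} = ∅ := by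
      ext x
      simp only [mem_inter_iff, mem_preimage, mem_singleton_iff, mem_empty_iff_false, iff_false]
      rintro ⟨⟨-, h1⟩, h2⟩
      exact ht (h2.symm.trans h1)
    simp [sliceArea, this]
  rw [h0] at h
  have h2 := (lintegral_eq_zero_iff measurable_gradient.enorm).1 h.symm
  filter_upwards [(ae_restrict_iff' hZ).1 h2] with x hx hxR hxc
  exact hg x hxR (by simpa using hx ⟨hxR, hxc⟩)

end Disintegration

end AnisoHessian

end

/-! ### The two integral identities -/

theorem mainTheorem8 (n k : ℕ) (hk : 1 ≤ k) (hkn : k ≤ n)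
    (F : EuclideanSpace ℝ (Fin n) → ℝ) (hF : AnisoHessian.IsStronglyConvexNorm F)
    (Ω : Set (EuclideanSpace ℝ (Fin n))) (hΩo : IsOpen Ω) (hΩb : Bornology.IsBounded Ω)
    (u : EuclideanSpace ℝ (Fin n) → ℝ) (hu : ContDiffOn ℝ 2 u Ω)
    (huc : ContinuousOn u (closure Ω)) (hu0 : ∀ x ∈ frontier Ω, u x = 0)
    (m M : ℝ) (hm : IsLeast (u '' closure Ω) m) (hM : IsGreatest (u '' closure Ω) M)
    (hint : IntegrableOn (AnisoHessian.newtonEnergy k F u) Ω volume) :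
    (IntegrableOn (fun x => (-u x) * AnisoHessian.anisoHessianOp k F u x) Ω volume →
      ∫ x in Ω, (-u x) * AnisoHessian.anisoHessianOp k F u x =
        (1 / (k : ℝ)) * ∫ x in Ω, AnisoHessian.newtonEnergy k F u x) ∧
    (∀ᵐ t ∂(volume.restrict (Set.Icc m M)),
      IntegrableOn (AnisoHessian.curvatureEnergy k F u) (AnisoHessian.levelSet Ω u t)
        (Measure.euclideanHausdorffMeasure (n - 1))) ∧
    IntervalIntegrable
      (fun t => ∫ x in AnisoHessian.levelSet Ω u t, AnisoHessian.curvatureEnergy k F u x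
        ∂(Measure.euclideanHausdorffMeasure (n - 1))) volume m M ∧
    (1 / (k : ℝ)) * ∫ x in Ω, AnisoHessian.newtonEnergy k F u x =
      (1 / (k : ℝ)) * ∫ t in m..M, ∫ x in AnisoHessian.levelSet Ω u t,
        AnisoHessian.curvatureEnergy k F u x
          ∂(Measure.euclideanHausdorffMeasure (n - 1)) := by
  have hu1 : ∀ x ∈ Ω, ContDiffAt ℝ 2 u x := fun x hx => hu.contDiffAt (hΩo.mem_nhds hx)
  have hgc : ContinuousOn (gradient u) Ω := fun x hx =>
    (AnisoHessian.contDiffAt_gradient_of_contDiffOn hΩo hu hx).continuousAt.continuousWithinAt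
  set R : Set (EuclideanSpace ℝ (Fin n)) := Ω ∩ gradient u ⁻¹' {0}ᶜ with hRdef
  have hRo : IsOpen R := hgc.isOpen_inter_preimage hΩo isOpen_compl_singleton
  have hRΩ : R ⊆ Ω := Set.inter_subset_left
  have huR : ∀ x ∈ R, ContDiffAt ℝ 1 u x := fun x hx => (hu1 x hx.1).of_le (by norm_num)
  have hgR : ∀ x ∈ R, gradient u x ≠ 0 := fun x hx => hx.2
  have hcrit : ∀ x ∈ Ω, x ∉ R → gradient u x = 0 := fun x hx hxR => by
    by_contra h
    exact hxR ⟨hx, h⟩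
  have hnull : ∀ᵐ x ∂(volume.restrict Ω), u x = 0 → AnisoHessian.newtonEnergy k F u x = 0 := by
    rw [ae_restrict_iff' hΩo.measurableSet]
    filter_upwards [AnisoHessian.ae_gradient_eq_zero_of_eq_const hRo huR hgR 0] with x hx hxΩ hx0
    refine AnisoHessian.newtonEnergy_of_gradient_eq_zero (hcrit x hxΩ fun hxR => hx hxR hx0) k
  have heq : ∀ x ∈ R, ‖gradient u x‖ * AnisoHessian.curvatureEnergy k F u x =
      AnisoHessian.newtonEnergy k F u x := fun x hx =>
    (hF.newtonEnergy_eq_norm_mul_curvatureEnergy (hu1 x hx.1) hx.2 hk hkn).symm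
  have hintR : IntegrableOn (fun x => ‖gradient u x‖ * AnisoHessian.curvatureEnergy k F u x) R :=
    (hint.mono_set hRΩ).congr_fun (fun x hx => (heq x hx).symm) hRo.measurableSet
  obtain ⟨h1, h2, h3⟩ := AnisoHessian.integral_norm_gradient_smul_eq hRo huR hgR hintR
  have hlevel : ∀ t, AnisoHessian.levelSet Ω u t = Ω ∩ u ⁻¹' {t} := fun t => rfl
  have hlm : ∀ t, MeasurableSet (AnisoHessian.levelSet Ω u t) := fun t =>
    AnisoHessian.measurableSet_inter_preimage_singleton hΩo (huc.mono subset_closure) t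
  have hsub : ∀ t, R ∩ u ⁻¹' {t} ⊆ AnisoHessian.levelSet Ω u t := fun t =>
    Set.inter_subset_inter_left _ hRΩ
  -- The curvature integrand vanishes at critical points, so the size of the critical part of a
  -- level set is irrelevant and no Sard-type theorem is needed.
  have hzero : ∀ t, ∀ x ∈ AnisoHessian.levelSet Ω u t \ (R ∩ u ⁻¹' {t}),
      AnisoHessian.curvatureEnergy k F u x = 0 := fun t x hx =>
    hF.curvatureEnergy_of_gradient_eq_zero (hcrit x hx.1.1 fun hxR => hx.2 ⟨hxR, hx.1.2⟩) k
  have hslice : ∀ t, ∫ x in AnisoHessian.levelSet Ω u t, AnisoHessian.curvatureEnergy k F u x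
        ∂(Measure.euclideanHausdorffMeasure (n - 1)) =
      ∫ x in R ∩ u ⁻¹' {t}, AnisoHessian.curvatureEnergy k F u x
        ∂(Measure.euclideanHausdorffMeasure (n - 1)) := fun t =>
    setIntegral_eq_of_subset_of_forall_sdiff_eq_zero (hlm t) (hsub t) (hzero t)
  have hmM : m ≤ M := hM.2 hm.1
  refine ⟨fun hS => AnisoHessian.integral_neg_mul_anisoHessianOp hF hΩo hΩb hu huc hu0 hk hkn hint hS
    hnull, ?_, ?_, ?_⟩
  · refine ae_restrict_of_ae (h1.mono fun t ht => ?_)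
    exact ht.of_forall_sdiff_eq_zero (hlm t) (hzero t)
  · simp only [hslice]
    exact h2.intervalIntegrable
  · congr 1
    have hE : ∫ x in Ω, AnisoHessian.newtonEnergy k F u x =
        ∫ x in R, ‖gradient u x‖ * AnisoHessian.curvatureEnergy k F u x := by
      rw [setIntegral_congr_fun hRo.measurableSet heq]
      exact setIntegral_eq_of_subset_of_forall_sdiff_eq_zero hΩo.measurableSet hRΩ fun x hx =>
        AnisoHessian.newtonEnergy_of_gradient_eq_zero (hcrit x hx.1 hx.2) k
    rw [hE, h3, intervalIntegral.integral_of_le hmM, ← integral_Icc_eq_integral_Ioc]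
    simp only [hslice]
    -- The coarea formula integrates over all `t` in `ℝ`; levels outside `[m, M]` are empty.
    refine (setIntegral_eq_integral_of_forall_compl_eq_zero fun t ht => ?_).symm
    have : R ∩ u ⁻¹' {t} = ∅ := by
      refine Set.eq_empty_of_forall_notMem fun x hx => ht ?_
      have hxm : u x ∈ u '' closure Ω := ⟨x, subset_closure (hRΩ hx.1), rfl⟩
      rw [← show u x = t from hx.2]
      exact ⟨hm.2 hxm, hM.2 hxm⟩
    rw [this, setIntegral_empty]
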